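/- **Setting.** Let $d\ge 1$, $T>0$, $I=(0,T]$, and let $\Omega\subset\mathbb R^d$ be a bounded open set (e.g. a polygonal/polyhedral Lipschitz domain). Let $a_{ij}\in L^\infty(I\times\Omega)$, $1\le i,j\le d$, satisfy $a_{ij}=a_{ji}$, $\sum_{i,j}a_{ij}(t,x)\xi_i\xi_j\ge\alpha|\xi|^2$ for all $\xi\in\mathbb R^d$ and a.e. $(t,x)\in I\times\Omega$ with some $\alpha>0$, be continuous in $t\in[0,T]$ for a.e. $x\in\Omega$, and satisfy $|a_{ij}(t_1,x)-a_{ij}(t_2,x)|\le\omega(|t_1-t_2|)$ for all $t_1,t_2\in[0,T]$ and a.e. $x\in\Omega$, where $\omega:[0,T]\to[0,\infty)$ is nondecreasing, $\omega(t)/t^{3/2}$ is nonincreasing on $(0,T]$ and $\int_0^T\omega(t)t^{-3/2}\,dt<\infty$. Put $a(t;u,v)=\int_\Omega\sum_{i,j}a_{ij}(t,x)\,\partial_iu\,\partial_jv\,dx$ for $u,v\in H^1_0(\Omega)$. Write $(\cdot,\cdot)$ and $\|\cdot\|$ for the inner product and norm of $L^2(\Omega)$. *Time mesh.* Consider partitions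 $0=t_0<t_1<\dots<t_M=T$ with $I_m=(t_{m-1},t_m]$, $k_m=t_m-t_{m-1}$, $k=\max_mk_m$, $k_{\min}=\min_mk_m$, satisfying, with fixed constants $c,\beta,\kappa>0$: (i) $k_{\min}\ge ck^\beta$; (ii) $\kappa^{-1}\le k_m/k_{m+1}\le\kappa$ for $1\le m\le M-1$; (iii) $k\le T/4$. *Space mesh.* Let $\mathcal T$ be an admissible (conformal) triangulation of $\Omega$, i.e. a finite family of $d$-simplices with union $\overline\Omega$, any two of which are disjoint or meet in a common face; no shape regularity or quasi-uniformity is assumed. For $r\ge1$ let $V_h$ be the space of all functions in $H^1_0(\Omega)$ that are polynomials of degree at most $r$ on each simplex of $\mathcal T$. Let $A_h(t):V_h\to V_h$ be given by $(A_h(t)v,\chi)=a(t;v,\chi)$ for all $\chi\in V_h$, and $A_{kh,m}=\frac1{k_m}\int_{I_m}A_h(t)\,dt$. *Fully discrete solution.* For $f\in L^1(I;L^2(\Omega))$ and $u_0\in L^2(\Omega)$ let $u_{kh}$, with constant value $u_{kh,m}\in V_h$ on $I_m$, be the solution of $$\sum_{m=1}^M\int_{I_m}a(t;u_{kh,m},\varphi_m)\,dt+\sum_{m=2}^M(u_{kh,m}-u_{kh,m-1},\varphi_m)+(u_{kh,1},\varphi_1)=\sum_{m=1}^M\int_{I_m}(f(t),\varphi_m)\,dt+(u_0,\varphi_1)$$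 for all $\varphi_1,\dots,\varphi_M\in V_h$. Put $[u_{kh}]_{m}=u_{kh,m+1}-u_{kh,m}$ for $1\le m\le M-1$, and $[u_{kh}]_0=u_{kh,1}-u_0$. **Theorem.** Given $\Omega$, $T$, $(a_{ij})$, $\alpha$, $\omega$, $c$, $\beta$, $\kappa$ as above, there exist $\mu>0$, $\delta_0>0$ and $C>0$ such that for every time mesh satisfying (i)–(iii) and $k-k_{\min}\le\delta_0$, every admissible triangulation $\mathcal T$ of $\Omega$, every $r\ge1$, every $f\in L^1(I;L^2(\Omega))$ and every $u_0\in L^2(\Omega)$, the fully discrete solution satisfies $$\sum_{m=1}^M\Bigl(k_m\|A_{kh,m}u_{kh,m}\|+\|[u_{kh}]_{m-1}\|\Bigr)\le Ce^{\mu T}\ln\frac Tk\Bigl(\|f\|_{L^1(I;L^2(\Omega))}+\|u_0\|\Bigr).$$ In particular $C$, $\mu$ and $\delta_0$ are independent of $k$ and $h=\max_{\tau\in\mathcal T}\operatorname{diam}\tau$. -/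

import Mathlib

open MeasureTheory Set
open scoped ENNReal InnerProductSpace

noncomputable section

namespace DGParabolic

/-! ### Sobolev space with zero boundary values -/

/-- Euclidean space of dimension `d`. -/
abbrev E (d : ℕ) : Type := EuclideanSpace ℝ (Fin d)

/-- The real Hilbert space `L²(Ω)`. -/
abbrev L2 {d : ℕ} (Ω : Set (E d)) : Type := Lp ℝ 2 (volume.restrict Ω)

/-- The classical `i`-th partial derivative of `φ`. -/
def pderiv {d : ℕ} (i : Fin d) (φ : E d → ℝ) (x : E d) : ℝ :=
  fderiv ℝ φ x (EuclideanSpace.single i 1)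

/-- `φ ∈ C_c^∞(Ω)`. -/
structure IsTestFunction {d : ℕ} (Ω : Set (E d)) (φ : E d → ℝ) : Prop where
  smooth : ContDiff ℝ (⊤ : ℕ∞) φ
  compact : HasCompactSupport φ
  support : tsupport φ ⊆ Ω

/-- `g` is the weak `i`-th partial derivative of `v` in `Ω`. -/
def HasWeakPartial {d : ℕ} (Ω : Set (E d)) (i : Fin d) (v g : L2 Ω) : Prop :=
  ∀ φ : E d → ℝ, IsTestFunction Ω φ →
    ∫ x in Ω, v x * pderiv i φ x = -∫ x in Ω, g x * φ x

open Classical in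
/-- The weak partial derivative `∂ᵢ v ∈ L²(Ω)` of `v`, if it exists (and `0` otherwise). On an open
set it is unique, so that the choice does not matter. -/
def weakPartial {d : ℕ} {Ω : Set (E d)} (i : Fin d) (v : L2 Ω) : L2 Ω :=
  if h : ∃ g : L2 Ω, HasWeakPartial Ω i v g then h.choose else 0

theorem IsTestFunction.zero {d : ℕ} (Ω : Set (E d)) : IsTestFunction Ω (0 : E d → ℝ) :=
  ⟨contDiff_const, HasCompactSupport.zero, by simp [tsupport]⟩

theorem IsTestFunction.add {d : ℕ} {Ω : Set (E d)} {φ ψ : E d → ℝ}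
    (hφ : IsTestFunction Ω φ) (hψ : IsTestFunction Ω ψ) : IsTestFunction Ω (φ + ψ) :=
  ⟨hφ.smooth.add hψ.smooth, hφ.compact.add hψ.compact,
    (tsupport_add φ ψ).trans (union_subset hφ.support hψ.support)⟩

theorem IsTestFunction.smul {d : ℕ} {Ω : Set (E d)} {φ : E d → ℝ}
    (c : ℝ) (hφ : IsTestFunction Ω φ) : IsTestFunction Ω (c • φ) :=
  ⟨hφ.smooth.const_smul c, hφ.compact.smul_left (f := fun _ => c),
    (tsupport_smul_subset_right (fun _ => c) φ).trans hφ.support⟩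

/-- The pairs `(φ, ∇φ)` with `φ ∈ C_c^∞(Ω)`, as a subspace of `L²(Ω) × L²(Ω)^d`. -/
def testPairs {d : ℕ} (Ω : Set (E d)) : Submodule ℝ (L2 Ω × (Fin d → L2 Ω)) where
  carrier := {p | ∃ φ : E d → ℝ, IsTestFunction Ω φ ∧ p.1 =ᵐ[volume.restrict Ω] φ ∧
    ∀ i, p.2 i =ᵐ[volume.restrict Ω] pderiv i φ}
  zero_mem' := by
    refine ⟨0, IsTestFunction.zero Ω, Lp.coeFn_zero _ _ _, fun i => ?_⟩
    filter_upwards [Lp.coeFn_zero ℝ 2 (volume.restrict Ω)] with x hx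
    simpa [pderiv] using hx
  add_mem' := by
    rintro p q ⟨φ, hφ, hp, hp'⟩ ⟨ψ, hψ, hq, hq'⟩
    refine ⟨φ + ψ, hφ.add hψ, ?_, fun i => ?_⟩
    · filter_upwards [Lp.coeFn_add p.1 q.1, hp, hq] with x hx h1 h2
      simp only [Prod.fst_add, hx, Pi.add_apply, h1, h2]
    · filter_upwards [Lp.coeFn_add (p.2 i) (q.2 i), hp' i, hq' i] with x hx h1 h2
      have hdφ : DifferentiableAt ℝ φ x := (hφ.smooth.differentiable (by simp)) x
      have hdψ : DifferentiableAt ℝ ψ x := (hψ.smooth.differentiable (by simp)) x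
      simp only [Prod.snd_add, Pi.add_apply, hx, h1, h2, pderiv, fderiv_add hdφ hdψ,
        _root_.add_apply]
  smul_mem' := by
    rintro c p ⟨φ, hφ, hp, hp'⟩
    refine ⟨c • φ, hφ.smul c, ?_, fun i => ?_⟩
    · filter_upwards [Lp.coeFn_smul c p.1, hp] with x hx h1
      simp only [Prod.smul_fst, hx, Pi.smul_apply, h1]
    · filter_upwards [Lp.coeFn_smul c (p.2 i), hp' i] with x hx h1
      have hdφ : DifferentiableAt ℝ φ x := (hφ.smooth.differentiable (by simp)) x
      simp only [Prod.smul_snd, Pi.smul_apply, hx, h1, pderiv, fderiv_const_smul hdφ c,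
        _root_.smul_apply]

/-- `H¹₀(Ω)`, the closure of `C_c^∞(Ω)` in `H¹(Ω)`: the functions `v ∈ L²(Ω)` that are `L²`-limits of
test functions whose gradients converge in `L²(Ω)^d` as well. -/
def H10 {d : ℕ} (Ω : Set (E d)) : Submodule ℝ (L2 Ω) :=
  (testPairs Ω).topologicalClosure.map (LinearMap.fst ℝ (L2 Ω) (Fin d → L2 Ω))

/-! ### The time-dependent elliptic operator -/

/-- The standing assumptions on the coefficients `a i j t x` of the operator
`A(t,x) u = -∑ i j, ∂ⱼ (a i j t x ∂ᵢ u)` on `(0,T) × Ω`, with ellipticity constant `α` and modulus of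
continuity in time `ω`. -/
structure IsAdmissible {d : ℕ} (Ω : Set (E d)) (T : ℝ) (a : Fin d → Fin d → ℝ → E d → ℝ)
    (α : ℝ) (ω : ℝ → ℝ) : Prop where
  bounded : ∀ i j, MemLp (fun p : ℝ × E d => a i j p.1 p.2) ∞
    ((volume.restrict (Ioo 0 T)).prod (volume.restrict Ω))
  symm : ∀ i j, ∀ᵐ p : ℝ × E d ∂(volume.restrict (Ioo 0 T)).prod (volume.restrict Ω),
    a i j p.1 p.2 = a j i p.1 p.2
  alpha_pos : 0 < α
  elliptic : ∀ᵐ p : ℝ × E d ∂(volume.restrict (Ioo 0 T)).prod (volume.restrict Ω),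
    ∀ ξ : E d, α * ‖ξ‖ ^ 2 ≤ ∑ i, ∑ j, a i j p.1 p.2 * ξ i * ξ j
  continuous : ∀ i j, ∀ᵐ x ∂volume.restrict Ω, ContinuousOn (fun t => a i j t x) (Icc 0 T)
  modulus : ∀ i j, ∀ t₁ ∈ Icc 0 T, ∀ t₂ ∈ Icc 0 T, ∀ᵐ x ∂volume.restrict Ω,
    |a i j t₁ x - a i j t₂ x| ≤ ω |t₁ - t₂|
  omega_nonneg : ∀ s ∈ Icc 0 T, 0 ≤ ω s
  omega_mono : MonotoneOn ω (Icc 0 T)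
  omega_anti : AntitoneOn (fun s => ω s / s ^ (3 / 2 : ℝ)) (Ioc 0 T)
  omega_int : IntegrableOn (fun s => ω s / s ^ (3 / 2 : ℝ)) (Ioc 0 T)

/-- The bilinear form `a(t; u, v) = ∫_Ω ∑ i j, a i j t x ∂ᵢu(x) ∂ⱼv(x) dx`. -/
def form {d : ℕ} {Ω : Set (E d)} (a : Fin d → Fin d → ℝ → E d → ℝ) (t : ℝ) (u v : L2 Ω) : ℝ :=
  ∫ x in Ω, ∑ i, ∑ j, a i j t x * weakPartial i u x * weakPartial j v x

/-! ### Finite elements in space -/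

/-- An admissible (conformal) triangulation of `Ω`: a finite simplicial complex, all of whose faces
belong to `d`-dimensional simplices, and whose simplices cover exactly the closure of `Ω`. No shape
regularity or quasi-uniformity is required. -/
structure Triangulation {d : ℕ} (Ω : Set (E d)) extends Geometry.SimplicialComplex ℝ (E d) where
  finite : faces.Finite
  pure : ∀ s ∈ faces, ∃ τ ∈ faces, s ⊆ τ ∧ τ.card = d + 1
  space_eq : toSimplicialComplex.space = closure Ω

/-- The finite element space `V_h`: all functions in `H¹₀(Ω)` that agree on each `d`-dimensional
simplex `τ` of the triangulation with a polynomial of degree at most `r`. -/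
def feSpace {d : ℕ} {Ω : Set (E d)} (𝒯 : Triangulation Ω) (r : ℕ) : Submodule ℝ (L2 Ω) where
  carrier := {v | v ∈ H10 Ω ∧ ∀ τ ∈ 𝒯.faces, τ.card = d + 1 →
    ∃ p : MvPolynomial (Fin d) ℝ, p.totalDegree ≤ r ∧
      ∀ᵐ x ∂volume.restrict Ω, x ∈ convexHull ℝ (τ : Set (E d)) →
        v x = MvPolynomial.eval (fun i => x i) p}
  zero_mem' := by
    refine ⟨zero_mem _, fun τ _ _ => ⟨0, by simp, ?_⟩⟩
    filter_upwards [Lp.coeFn_zero ℝ 2 (volume.restrict Ω)] with x hx _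
    simpa using hx
  add_mem' := by
    rintro u v ⟨hu, hu'⟩ ⟨hv, hv'⟩
    refine ⟨add_mem hu hv, fun τ hτ hc => ?_⟩
    obtain ⟨p, hp, hpe⟩ := hu' τ hτ hc
    obtain ⟨q, hq, hqe⟩ := hv' τ hτ hc
    refine ⟨p + q, (MvPolynomial.totalDegree_add p q).trans (max_le hp hq), ?_⟩
    filter_upwards [Lp.coeFn_add u v, hpe, hqe] with x hx h1 h2 hxτ
    rw [hx, Pi.add_apply, h1 hxτ, h2 hxτ, map_add]
  smul_mem' := by
    rintro c u ⟨hu, hu'⟩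
    refine ⟨Submodule.smul_mem _ c hu, fun τ hτ hc => ?_⟩
    obtain ⟨p, hp, hpe⟩ := hu' τ hτ hc
    refine ⟨c • p, (MvPolynomial.totalDegree_smul_le c p).trans hp, ?_⟩
    filter_upwards [Lp.coeFn_smul c u, hpe] with x hx h1 hxτ
    rw [hx, Pi.smul_apply, h1 hxτ, MvPolynomial.smul_eval, smul_eq_mul]

open Classical in
/-- The discrete operator `A_h(t) : V → V` on a finite element space `V`, determined by
`(A_h(t) v, χ) = a(t; v, χ)` for all `χ ∈ V`, where `(·,·)` is the `L²(Ω)` inner product. -/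
def discreteOp {d : ℕ} {Ω : Set (E d)} (a : Fin d → Fin d → ℝ → E d → ℝ)
    (V : Submodule ℝ (L2 Ω)) (t : ℝ) (v : V) : V :=
  if h : ∃ z : V, ∀ χ : V, ⟪(z : L2 Ω), (χ : L2 Ω)⟫_ℝ = form a t (v : L2 Ω) (χ : L2 Ω)
  then h.choose else 0

/-! ### The time mesh and the fully discrete scheme -/

/-- A partition `0 = t₀ < t₁ < ⋯ < t_M = T`, with intervals `I_m = (t_{m-1}, t_m]`, `1 ≤ m ≤ M`.
Only the values `t m` with `m ≤ M` matter. -/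
structure TimeMesh (T : ℝ) where
  M : ℕ
  t : ℕ → ℝ
  t_zero : t 0 = 0
  t_last : t M = T
  t_lt : ∀ m < M, t m < t (m + 1)

namespace TimeMesh

variable {T : ℝ} (Δ : TimeMesh T)

/-- The step length `k_m = t_m - t_{m-1}`, for `1 ≤ m ≤ M`. -/
def step (m : ℕ) : ℝ := Δ.t m - Δ.t (m - 1)

/-- The maximal step length `k`. -/
def kmax : ℝ := sSup (Δ.step '' Icc 1 Δ.M)

/-- The minimal step length `k_min`. -/
def kmin : ℝ := sInf (Δ.step '' Icc 1 Δ.M)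

/-- The conditions on the time mesh, with constants `c`, `β`, `κ`. -/
structure IsRegular (c β κ : ℝ) : Prop where
  kmin_ge : c * Δ.kmax ^ β ≤ Δ.kmin
  ratio : ∀ m, 1 ≤ m → m < Δ.M →
    κ⁻¹ ≤ Δ.step m / Δ.step (m + 1) ∧ Δ.step m / Δ.step (m + 1) ≤ κ
  kmax_le : Δ.kmax ≤ T / 4

end TimeMesh

variable {d : ℕ} {Ω : Set (E d)} {T : ℝ}

/-- The average `A_{kh,m} = k_m⁻¹ ∫_{I_m} A_h(t) dt`, applied to `v`. -/
def avgOp (a : Fin d → Fin d → ℝ → E d → ℝ) (V : Submodule ℝ (L2 Ω)) (Δ : TimeMesh T)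
    (m : ℕ) (v : V) : V :=
  (Δ.step m)⁻¹ • ∫ s in Δ.t (m - 1)..Δ.t m, discreteOp a V s v

/-- The dG(0) bilinear form `B(u, φ)` for `u`, `φ` piecewise constant in time. Such a function is
given by its values `u m ∈ V` on `I_m`, `1 ≤ m ≤ M` (other values are irrelevant). -/
def dgForm (a : Fin d → Fin d → ℝ → E d → ℝ) (V : Submodule ℝ (L2 Ω)) (Δ : TimeMesh T)
    (u φ : ℕ → V) : ℝ :=
  (∑ m ∈ Finset.Icc 1 Δ.M,
      ∫ s in Δ.t (m - 1)..Δ.t m, form a s (u m : L2 Ω) (φ m : L2 Ω))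
    + (∑ m ∈ Finset.Icc 2 Δ.M, ⟪(u m : L2 Ω) - (u (m - 1) : L2 Ω), (φ m : L2 Ω)⟫_ℝ)
    + ⟪(u 1 : L2 Ω), (φ 1 : L2 Ω)⟫_ℝ

/-- `u` is the fully discrete solution:
`B(u, φ) = (f, φ)_{I × Ω} + (u₀, φ₁)_Ω` for all `φ` in the space-time finite element space. -/
def IsFullyDiscreteSolution (a : Fin d → Fin d → ℝ → E d → ℝ) (V : Submodule ℝ (L2 Ω))
    (Δ : TimeMesh T) (f : ℝ → L2 Ω) (u₀ : L2 Ω) (u : ℕ → V) : Prop :=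
  ∀ φ : ℕ → V, dgForm a V Δ u φ =
    (∑ m ∈ Finset.Icc 1 Δ.M, ∫ s in Δ.t (m - 1)..Δ.t m, ⟪f s, (φ m : L2 Ω)⟫_ℝ)
      + ⟪u₀, (φ 1 : L2 Ω)⟫_ℝ

/-- The jump `[u]_m = u_{m+1} - u_m` at `t_m`, where the value before `t₀ = 0` is the initial datum
`u₀`. -/
def jump {V : Submodule ℝ (L2 Ω)} (u₀ : L2 Ω) (u : ℕ → V) (m : ℕ) : L2 Ω :=
  if m = 0 then (u 1 : L2 Ω) - u₀ else (u (m + 1) : L2 Ω) - (u m : L2 Ω)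

end DGParabolic

end

namespace DGParabolic

/-! ### Products of resolvent factors -/

/-! Tested on one time step at a time, the method is an implicit Euler scheme v_m + k_m A_m v_m =
v_{m-1} + F_m with v_0 = 0, where A_m is symmetric and coercive on V_h and the initial datum is part
of F_1. Freeze the operator at step n: A_n v_n is the sum over m ≤ n of A_n R F_m and k_m A_n R (A_n
- A_m) v_m, with R = ∏_{j=m}^n (1 + k_j A_n)⁻¹ (`scheme_duhamel`). All of this is diagonal in an
eigenbasis of A_n, so only scalar bounds for ∏ (1 + k_j λ) matter and no constant sees the space
mesh.

Put S = t_n - t_{m-1}. In the first sum ‖A_n R‖ ≤ 1/S; weighting by k_n and summing over n produces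
the logarithm, thanks to the lower bound on k_min (`sum_step_div_le`, `one_add_log_le`). In the
second, (A_n - A_m) v_m is a functional of size ω(S) N(v_m) on the energy space, and A_n R maps such
functionals into L² with norm of order S^{-3/2} (`sq_norm_diagOp_le`, `resolvent_symbol_cube_le`).
Summing k_n ω(S) S^{-3/2} over n stays below the integral of ω(s) s^{-3/2}, and ∑ k_m N(v_m) is
controlled by the energy estimate (`sum_step_mul_le_of_scheme`). As that estimate bounds v by the
data directly, the perturbation needs neither absorption nor a Gronwall argument. The jumps are then
read off from the scheme (`norm_jump_le`). -/

theorem one_add_sum_le_prod_one_add {ι : Type*} (s : Finset ι) (x : ι → ℝ)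
    (hx : ∀ i ∈ s, 0 ≤ x i) :
    1 + ∑ i ∈ s, x i ≤ ∏ i ∈ s, (1 + x i) ∧
    1 + ∑ i ∈ s, x i + ((∑ i ∈ s, x i) ^ 2 - ∑ i ∈ s, x i ^ 2) / 2 ≤ ∏ i ∈ s, (1 + x i) := by
  classical
  induction s using Finset.induction with
  | empty => simp
  | insert a s ha ih =>
    have h0 := hx a (Finset.mem_insert_self a s)
    have hs : 0 ≤ ∑ i ∈ s, x i :=
      Finset.sum_nonneg fun i hi => hx i (Finset.mem_insert_of_mem hi)
    obtain ⟨h1, h2⟩ := ih fun i hi => hx i (Finset.mem_insert_of_mem hi)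
    rw [Finset.sum_insert ha, Finset.prod_insert ha, Finset.sum_insert ha]
    have h3 := mul_le_mul_of_nonneg_left h1 h0
    have h4 := mul_nonneg h0 hs
    -- The second elementary symmetric function grows by `x a` times the old sum, which is supplied
    -- by the first bound multiplied by `x a`.
    constructor <;> nlinarith

/-- The solution of a scalar two-term recursion. -/
theorem recursion_solution (x y r : ℕ → ℝ) (n : ℕ) (hx : ∀ m ∈ Finset.Icc 1 n, 0 ≤ x m)
    (hy0 : y 0 = 0) (hy : ∀ m ∈ Finset.Icc 1 n, (1 + x m) * y m = y (m - 1) + r m) :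
    y n = ∑ m ∈ Finset.Icc 1 n, (∏ j ∈ Finset.Icc m n, (1 + x j))⁻¹ * r m := by
  induction n with
  | zero => simp [hy0]
  | succ n ih =>
    have hsub : ∀ m ∈ Finset.Icc 1 n, m ∈ Finset.Icc 1 (n + 1) := fun m hm => by
      simp only [Finset.mem_Icc] at hm ⊢; omega
    have ih' := ih (fun m hm => hx m (hsub m hm)) (fun m hm => hy m (hsub m hm))
    have hl : n + 1 ∈ Finset.Icc 1 (n + 1) := by simp
    have h1 := hx _ hl
    have h2 := hy _ hl
    rw [Nat.add_sub_cancel, ih'] at h2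
    have h3 : 1 + x (n + 1) ≠ 0 := by positivity
    rw [Finset.sum_Icc_succ_top (by omega), Finset.Icc_self, Finset.prod_singleton,
      eq_comm, ← mul_right_inj' h3, h2, mul_add, Finset.mul_sum]
    congr 1
    · refine Finset.sum_congr rfl fun m hm => ?_
      rw [Finset.prod_Icc_succ_top (by simp only [Finset.mem_Icc] at hm; omega), mul_inv]
      field_simp
    · field_simp

/-! ### Functions of a symmetric operator in an eigenbasis -/

section Diag

variable {V : Type*} [NormedAddCommGroup V] [InnerProductSpace ℝ V]
variable {ι : Type*} [Fintype ι] (b : OrthonormalBasis ι ℝ V)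

/-- The operator with eigenvalues `c i` in the orthonormal basis `b`. -/
noncomputable def diagOp (c : ι → ℝ) (v : V) : V := ∑ i, (c i * ⟪b i, v⟫_ℝ) • b i

theorem inner_diagOp (c : ι → ℝ) (v : V) (i : ι) :
    ⟪b i, diagOp b c v⟫_ℝ = c i * ⟪b i, v⟫_ℝ := by
  rw [diagOp, b.orthonormal.inner_right_fintype]

theorem inner_eq_sum (x y : V) : ⟪x, y⟫_ℝ = ∑ i, ⟪b i, x⟫_ℝ * ⟪b i, y⟫_ℝ := by
  rw [← b.sum_inner_mul_inner x y]
  exact Finset.sum_congr rfl fun i _ => by rw [real_inner_comm]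

theorem norm_diagOp_le (c : ι → ℝ) (B : ℝ) (hB : 0 ≤ B) (hc : ∀ i, |c i| ≤ B) (v : V) :
    ‖diagOp b c v‖ ≤ B * ‖v‖ := by
  refine le_of_sq_le_sq ?_ (by positivity)
  rw [mul_pow, ← real_inner_self_eq_norm_sq, ← real_inner_self_eq_norm_sq, inner_eq_sum b,
    inner_eq_sum b v v, Finset.mul_sum]
  refine Finset.sum_le_sum fun i _ => ?_
  rw [inner_diagOp]
  have := sq_le_sq' (by linarith [(abs_le.1 (hc i)).1]) ((abs_le.1 (hc i)).2)
  nlinarith [mul_le_mul_of_nonneg_right this (mul_self_nonneg ⟪b i, v⟫_ℝ)]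

/-- Smoothing of functionals that are bounded in the energy norm. -/
theorem sq_norm_diagOp_le (A : V →ₗ[ℝ] V) (hA : A.IsSymmetric) (lam : ι → ℝ)
    (hlam : ∀ i, A (b i) = lam i • b i) (N : V → ℝ) (γ : ℝ) (hγ : 0 < γ)
    (hN : ∀ x, γ * N x ^ 2 ≤ ⟪A x, x⟫_ℝ) (g : V) (ε : ℝ)
    (hg : ∀ x, |⟪g, x⟫_ℝ| ≤ ε * N x) (c : ι → ℝ) (B : ℝ)
    (hB : 0 ≤ B) (hc : ∀ i, lam i * c i ^ 2 ≤ B) :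
    γ * ‖diagOp b c g‖ ^ 2 ≤ ε ^ 2 * B := by
  set w := diagOp b c g with hw
  -- Duality with x = c(A)² g: the pairing ⟪g, x⟫ is exactly ‖c(A) g‖², while the energy of x is at
  -- most B ‖c(A) g‖². One factor ‖c(A) g‖² is cancelled at the end.
  set x := diagOp b (fun i => c i ^ 2) g with hx
  have hwn : ‖w‖ ^ 2 = ∑ i, (c i) ^ 2 * ⟪b i, g⟫_ℝ ^ 2 := by
    rw [← real_inner_self_eq_norm_sq, inner_eq_sum b]
    exact Finset.sum_congr rfl fun i _ => by rw [hw, inner_diagOp]; ring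
  have hgx : ⟪g, x⟫_ℝ = ‖w‖ ^ 2 := by
    rw [hwn, inner_eq_sum b]
    exact Finset.sum_congr rfl fun i _ => by rw [hx, inner_diagOp]; ring
  have hAx : ⟪A x, x⟫_ℝ ≤ B * ‖w‖ ^ 2 := by
    rw [hwn, inner_eq_sum b, Finset.mul_sum]
    refine Finset.sum_le_sum fun i _ => ?_
    rw [← hA (b i) x, hlam, real_inner_smul_left, hx, inner_diagOp]
    nlinarith [mul_le_mul_of_nonneg_right (hc i) (by positivity :
      0 ≤ c i ^ 2 * ⟪b i, g⟫_ℝ ^ 2)]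
  have h1 := (le_abs_self _).trans (hg x)
  rw [hgx] at h1
  have h2 : (‖w‖ ^ 2) ^ 2 ≤ (ε * N x) ^ 2 := pow_le_pow_left₀ (by positivity) h1 2
  have h3 := hN x
  have h4 : γ * ‖w‖ ^ 2 * ‖w‖ ^ 2 ≤ ε ^ 2 * B * ‖w‖ ^ 2 := by
    nlinarith [mul_le_mul_of_nonneg_left (h3.trans hAx) (sq_nonneg ε),
      mul_le_mul_of_nonneg_left h2 hγ.le]
  rcases eq_or_lt_of_le (sq_nonneg ‖w‖) with h0 | h0
  · rw [← h0, mul_zero]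
    positivity
  · exact le_of_mul_le_mul_right h4 h0

end Diag

/-! ### Time meshes -/

namespace TimeMesh

variable {T : ℝ} (Δ : TimeMesh T)

theorem t_mono {m n : ℕ} (hmn : m ≤ n) (hn : n ≤ Δ.M) : Δ.t m ≤ Δ.t n := by
  induction n, hmn using Nat.le_induction with
  | base => exact le_rfl
  | succ n hmn ih => exact (ih (by omega)).trans (Δ.t_lt n (by omega)).le

theorem t_nonneg {m : ℕ} (hm : m ≤ Δ.M) : 0 ≤ Δ.t m := by
  simpa [Δ.t_zero] using Δ.t_mono (Nat.zero_le m) hm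

theorem t_le {m : ℕ} (hm : m ≤ Δ.M) : Δ.t m ≤ T := by
  simpa [Δ.t_last] using Δ.t_mono hm le_rfl

theorem step_pos {m : ℕ} (h1 : 1 ≤ m) (hm : m ≤ Δ.M) : 0 < Δ.step m := by
  have := Δ.t_lt (m - 1) (by omega)
  rw [Nat.sub_add_cancel h1] at this
  exact sub_pos.2 this

theorem M_pos (hT : 0 < T) : 1 ≤ Δ.M := by
  by_contra h
  have h0 : Δ.M = 0 := by omega
  have h1 := Δ.t_last
  rw [h0, Δ.t_zero] at h1
  exact hT.ne h1

theorem sum_step {m n : ℕ} (hmn : m ≤ n) :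
    ∑ j ∈ Finset.Icc m n, Δ.step j = Δ.t n - Δ.t (m - 1) := by
  induction n, hmn using Nat.le_induction with
  | base => simp [step]
  | succ n hmn ih =>
    rw [Finset.sum_Icc_succ_top (by omega), ih]
    simp [step]

theorem finite_steps : (Δ.step '' Icc 1 Δ.M).Finite := (finite_Icc 1 Δ.M).image _

theorem step_le_kmax {m : ℕ} (h1 : 1 ≤ m) (hm : m ≤ Δ.M) : Δ.step m ≤ Δ.kmax :=
  le_csSup Δ.finite_steps.bddAbove ⟨m, ⟨h1, hm⟩, rfl⟩

theorem kmin_le_step {m : ℕ} (h1 : 1 ≤ m) (hm : m ≤ Δ.M) : Δ.kmin ≤ Δ.step m :=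
  csInf_le Δ.finite_steps.bddBelow ⟨m, ⟨h1, hm⟩, rfl⟩

theorem kmax_pos (hT : 0 < T) : 0 < Δ.kmax :=
  (Δ.step_pos le_rfl (Δ.M_pos hT)).trans_le (Δ.step_le_kmax le_rfl (Δ.M_pos hT))

variable {Δ}

/-- With a bounded ratio of neighbouring steps, no step dominates a union of two or more of them. -/
theorem IsRegular.step_le {c β κ : ℝ} (h : Δ.IsRegular c β κ) (hκ : 0 < κ) {m n j : ℕ}
    (h1 : 1 ≤ m) (hmn : m < n) (hn : n ≤ Δ.M) (hj : j ∈ Finset.Icc m n) :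
    (1 + κ) * Δ.step j ≤ κ * (Δ.t n - Δ.t (m - 1)) := by
  rw [Finset.mem_Icc] at hj
  -- A neighbour of j inside the range: the successor, or the predecessor when j = n, which exists
  -- since m < n. The two cases use the two sides of the ratio condition.
  have key : ∃ i ∈ Finset.Icc m n, i ≠ j ∧ Δ.step j ≤ κ * Δ.step i := by
    rcases Nat.lt_or_ge j n with hjn | hjn
    · refine ⟨j + 1, by simp only [Finset.mem_Icc]; omega, by omega, ?_⟩
      have := (h.ratio j (by omega) (by omega)).2
      rwa [div_le_iff₀ (Δ.step_pos (by omega) (by omega))] at this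
    · refine ⟨j - 1, by simp only [Finset.mem_Icc]; omega, by omega, ?_⟩
      have := (h.ratio (j - 1) (by omega) (by omega)).1
      rw [Nat.sub_add_cancel (by omega), le_div_iff₀ (Δ.step_pos (by omega) (by omega)),
        inv_mul_le_iff₀ hκ] at this
      exact this
  obtain ⟨i, hi, hij, hle⟩ := key
  have hs : Δ.step i + Δ.step j ≤ Δ.t n - Δ.t (m - 1) := by
    rw [← Δ.sum_step hmn.le, ← Finset.sum_pair hij]
    refine Finset.sum_le_sum_of_subset_of_nonneg ?_ fun l hl _ => ?_
    · intro l hl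
      simp only [Finset.mem_insert, Finset.mem_singleton, Finset.mem_Icc] at hl hi ⊢
      omega
    · rw [Finset.mem_Icc] at hl
      exact (Δ.step_pos (by omega) (by omega)).le
  nlinarith

variable (Δ)

theorem prod_resolvent_ge {m n : ℕ} (h1 : 1 ≤ m) (hmn : m ≤ n) (hn : n ≤ Δ.M) {lam : ℝ}
    (hlam : 0 ≤ lam) :
    1 + lam * (Δ.t n - Δ.t (m - 1)) ≤ ∏ j ∈ Finset.Icc m n, (1 + Δ.step j * lam) := by
  refine le_of_eq_of_le ?_ (one_add_sum_le_prod_one_add _ _ fun j hj => ?_).1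
  · rw [← Finset.sum_mul, Δ.sum_step hmn, mul_comm]
  · rw [Finset.mem_Icc] at hj
    exact mul_nonneg (Δ.step_pos (by omega) (by omega)).le hlam

variable {Δ}

/-- The product dominates the second elementary symmetric function of the k_j λ. By `step_le` the
diagonal part ∑ (k_j λ)² takes up at most the fraction κ/(1+κ) of (λS)², so quadratic growth
survives. A single factor grows only linearly, hence m < n. -/
theorem IsRegular.prod_resolvent_ge_sq {c β κ : ℝ} (h : Δ.IsRegular c β κ) (hκ : 0 < κ) {m n : ℕ}
    (h1 : 1 ≤ m) (hmn : m < n) (hn : n ≤ Δ.M) {lam : ℝ} (hlam : 0 ≤ lam) :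
    (lam * (Δ.t n - Δ.t (m - 1))) ^ 2 ≤
      2 * (1 + κ) * ∏ j ∈ Finset.Icc m n, (1 + Δ.step j * lam) := by
  have hpos : ∀ j ∈ Finset.Icc m n, 0 ≤ Δ.step j := fun j hj => by
    rw [Finset.mem_Icc] at hj
    exact (Δ.step_pos (by omega) (by omega)).le
  have hp := (one_add_sum_le_prod_one_add (Finset.Icc m n) (fun j => Δ.step j * lam)
    fun j hj => mul_nonneg (hpos j hj) hlam).2
  have hsum := Δ.sum_step hmn.le
  set S := Δ.t n - Δ.t (m - 1)
  have hS : 0 ≤ S := hsum ▸ Finset.sum_nonneg hpos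
  have hq : (1 + κ) * ∑ j ∈ Finset.Icc m n, (Δ.step j * lam) ^ 2 ≤ κ * (S * lam) ^ 2 := by
    have : κ * (S * lam) ^ 2 = ∑ j ∈ Finset.Icc m n, κ * S * Δ.step j * lam ^ 2 := by
      rw [← Finset.sum_mul, ← Finset.mul_sum, hsum]; ring
    rw [this, Finset.mul_sum]
    refine Finset.sum_le_sum fun j hj => ?_
    have := mul_le_mul_of_nonneg_right (h.step_le hκ h1 hmn hn hj)
      (mul_nonneg (hpos j hj) (sq_nonneg lam))
    nlinarith
  rw [← Finset.sum_mul, hsum] at hp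
  have h3 := mul_le_mul_of_nonneg_left hp (by positivity : 0 ≤ 2 * (1 + κ))
  have h4 : 0 ≤ S * lam := mul_nonneg hS hlam
  nlinarith [mul_nonneg hκ.le h4]

theorem t_sub_pos {m n : ℕ} (h1 : 1 ≤ m) (hmn : m ≤ n) (hn : n ≤ Δ.M) :
    0 < Δ.t n - Δ.t (m - 1) := by
  have h := Δ.step_pos (m := m) (by omega) (by omega)
  have h' := Δ.t_mono hmn hn
  rw [step] at h
  linarith

variable (Δ)

/-- `‖λ ∏ (1 + k_j λ)⁻¹‖ ≤ 1 / (t_n - t_{m-1})`. -/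
theorem resolvent_symbol_le {m n : ℕ} (h1 : 1 ≤ m) (hmn : m ≤ n) (hn : n ≤ Δ.M) {lam : ℝ}
    (hlam : 0 ≤ lam) :
    |lam * (∏ j ∈ Finset.Icc m n, (1 + Δ.step j * lam))⁻¹| ≤ (Δ.t n - Δ.t (m - 1))⁻¹ := by
  have hS := Δ.t_sub_pos h1 hmn hn
  have hp := Δ.prod_resolvent_ge h1 hmn hn hlam
  have hP : 0 < ∏ j ∈ Finset.Icc m n, (1 + Δ.step j * lam) :=
    lt_of_lt_of_le (by positivity) hp
  rw [abs_of_nonneg (by positivity), ← div_eq_mul_inv, div_le_iff₀ hP, ← div_eq_inv_mul,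
    le_div_iff₀ hS]
  linarith

variable {Δ}

/-- One factor P of P² absorbs (λS)² through the quadratic bound, the other absorbs λS through the
linear one. -/
theorem IsRegular.resolvent_symbol_cube_le {c β κ : ℝ} (h : Δ.IsRegular c β κ) (hκ : 0 < κ)
    {m n : ℕ} (h1 : 1 ≤ m) (hmn : m < n) (hn : n ≤ Δ.M) {lam : ℝ} (hlam : 0 ≤ lam) :
    lam * (lam * (∏ j ∈ Finset.Icc m n, (1 + Δ.step j * lam))⁻¹) ^ 2
      ≤ 2 * (1 + κ) / (Δ.t n - Δ.t (m - 1)) ^ 3 := by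
  have hS := Δ.t_sub_pos h1 hmn.le hn
  have hp := Δ.prod_resolvent_ge h1 hmn.le hn hlam
  have hp2 := h.prod_resolvent_ge_sq hκ h1 hmn hn hlam
  set P := ∏ j ∈ Finset.Icc m n, (1 + Δ.step j * lam)
  set S := Δ.t n - Δ.t (m - 1)
  have hP : 0 < P := lt_of_lt_of_le (by positivity) hp
  rw [le_div_iff₀ (by positivity)]
  have : lam * (lam * P⁻¹) ^ 2 * S ^ 3 = (lam * S) ^ 2 * (lam * S) / P ^ 2 := by
    field_simp
  rw [this, div_le_iff₀ (by positivity)]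
  calc (lam * S) ^ 2 * (lam * S) ≤ (2 * (1 + κ) * P) * P :=
        mul_le_mul hp2 (by linarith) (by positivity) (by positivity)
    _ = _ := by ring

/-! ### Sums over the mesh -/

variable (Δ)

/-- Each term with n > m equals 1 - S_{n-1}/S_n ≤ log (S_n / S_{n-1}), where S_n = t_n - t_{m-1},
and these logarithms telescope. The term n = m is the summand 1. -/
theorem sum_step_div_le {m N : ℕ} (h1 : 1 ≤ m) (hm : m ≤ N) (hN : N ≤ Δ.M) :
    ∑ n ∈ Finset.Icc m N, Δ.step n * (Δ.t n - Δ.t (m - 1))⁻¹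
      ≤ 1 + Real.log ((Δ.t N - Δ.t (m - 1)) / Δ.step m) := by
  have hk := Δ.step_pos h1 (hm.trans hN)
  induction N, hm using Nat.le_induction with
  | base =>
    rw [Finset.Icc_self, Finset.sum_singleton]
    change Δ.step m * (Δ.step m)⁻¹ ≤ 1 + Real.log (Δ.step m / Δ.step m)
    rw [mul_inv_cancel₀ hk.ne', div_self hk.ne', Real.log_one, add_zero]
  | succ N hm ih =>
    have ih' := ih (by omega)
    have h2 := Δ.t_sub_pos h1 hm (by omega)
    have h3 := Δ.t_sub_pos (m := m) (n := N + 1) h1 (by omega) hN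
    rw [Finset.sum_Icc_succ_top (by omega)]
    rw [Real.log_div h2.ne' hk.ne'] at ih'
    rw [Real.log_div h3.ne' hk.ne']
    have h4 := Real.log_le_sub_one_of_pos (div_pos h2 h3)
    rw [Real.log_div h2.ne' h3.ne'] at h4
    have h5 : Δ.step (N + 1) * (Δ.t (N + 1) - Δ.t (m - 1))⁻¹
        = 1 - (Δ.t N - Δ.t (m - 1)) / (Δ.t (N + 1) - Δ.t (m - 1)) := by
      rw [step, Nat.add_sub_cancel]
      field_simp
      ring
    linarith

/-- For a decreasing function, values at right endpoints give a lower Riemann sum. -/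
theorem sum_step_mul_antitone_le {h : ℝ → ℝ} (hanti : AntitoneOn h (Ioc 0 T))
    (hnn : ∀ s ∈ Ioc 0 T, 0 ≤ h s) (hint : IntegrableOn h (Ioc 0 T)) {m : ℕ} (h1 : 1 ≤ m)
    (hm : m ≤ Δ.M) :
    ∑ n ∈ Finset.Icc (m + 1) Δ.M, Δ.step n * h (Δ.t n - Δ.t (m - 1)) ≤ ∫ s in Ioc 0 T, h s := by
  have key : ∀ N, m ≤ N → N ≤ Δ.M →
      ∑ n ∈ Finset.Icc (m + 1) N, Δ.step n * h (Δ.t n - Δ.t (m - 1))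
        ≤ ∫ s in Ioc 0 (Δ.t N - Δ.t (m - 1)), h s := by
    intro N hmN
    induction N, hmN using Nat.le_induction with
    | base =>
      intro _
      rw [Finset.Icc_eq_empty (by omega), Finset.sum_empty]
      refine setIntegral_nonneg measurableSet_Ioc fun s hs => hnn s ⟨hs.1, hs.2.trans ?_⟩
      linarith [Δ.t_le hm, Δ.t_nonneg (m := m - 1) (by omega)]
    | succ N hmN ih =>
      intro hN
      have h2 := Δ.t_sub_pos h1 hmN (by omega)
      have h3 := Δ.t_le hN
      have h4 := Δ.t_nonneg (m := m - 1) (by omega)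
      have h5 := Δ.t_lt N (by omega)
      rw [Finset.sum_Icc_succ_top (by omega),
        ← Ioc_union_Ioc_eq_Ioc h2.le (sub_le_sub_right h5.le _),
        setIntegral_union (Ioc_disjoint_Ioc_of_le le_rfl) measurableSet_Ioc
          (hint.mono_set (Ioc_subset_Ioc le_rfl (by linarith)))
          (hint.mono_set (Ioc_subset_Ioc h2.le (by linarith)))]
      refine add_le_add (ih (by omega)) ?_
      have h6 : ∫ s in Ioc (Δ.t N - Δ.t (m - 1)) (Δ.t (N + 1) - Δ.t (m - 1)),
          h (Δ.t (N + 1) - Δ.t (m - 1)) = Δ.step (N + 1) * h (Δ.t (N + 1) - Δ.t (m - 1)) := by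
        rw [setIntegral_const, smul_eq_mul, Real.volume_real_Ioc_of_le (by linarith), step,
          Nat.add_sub_cancel]
        ring
      rw [← h6]
      refine setIntegral_mono_on (integrableOn_const (by simp))
        (hint.mono_set (Ioc_subset_Ioc h2.le (by linarith))) measurableSet_Ioc fun s hs => ?_
      exact hanti ⟨h2.trans hs.1, by linarith [hs.2]⟩ ⟨by linarith, by linarith⟩ hs.2
  refine (key Δ.M hm le_rfl).trans ?_
  rw [Δ.t_last]
  refine setIntegral_mono_set hint ?_ ?_
  · filter_upwards [ae_restrict_mem measurableSet_Ioc] with s hs using hnn s hs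
  · exact (Ioc_subset_Ioc le_rfl (by linarith [Δ.t_nonneg (m := m - 1) (by omega)])).eventuallyLE

variable {Δ}

/-- The mesh condition `k_min ≥ c k ^ β` bounds all logarithms of steps. -/
theorem IsRegular.one_add_log_le {c β κ : ℝ} (h : Δ.IsRegular c β κ) (hT : 0 < T) (hc : 0 < c)
    {m : ℕ} (h1 : 1 ≤ m) (hm : m ≤ Δ.M) :
    1 + Real.log (T / Δ.step m)
      ≤ (1 + |Real.log (T / (c * T ^ β))| + β) * Real.log (T / Δ.kmax) ∧
    1 ≤ Real.log (T / Δ.kmax) := by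
  have hk := Δ.kmax_pos hT
  have hL : 1 ≤ Real.log (T / Δ.kmax) := by
    rw [Real.le_log_iff_exp_le (by positivity), le_div_iff₀ hk]
    nlinarith [h.kmax_le, Real.exp_one_lt_d9, Real.exp_pos 1]
  refine ⟨?_, hL⟩
  have hs := Δ.step_pos h1 hm
  have h2 : c * Δ.kmax ^ β ≤ Δ.step m := h.kmin_ge.trans (Δ.kmin_le_step h1 hm)
  have hkβ : 0 < Δ.kmax ^ β := Real.rpow_pos_of_pos hk _
  have hTβ : 0 < T ^ β := Real.rpow_pos_of_pos hT _
  have h3 := Real.log_le_log (by positivity) h2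
  rw [Real.log_mul hc.ne' hkβ.ne', Real.log_rpow hk] at h3
  have h4 := le_abs_self (Real.log (T / (c * T ^ β)))
  have h5 := abs_nonneg (Real.log (T / (c * T ^ β)))
  have h6 : Real.log (T / (c * T ^ β)) = Real.log T - (Real.log c + β * Real.log T) := by
    rw [Real.log_div hT.ne' (by positivity), Real.log_mul hc.ne' hTβ.ne', Real.log_rpow hT]
  rw [Real.log_div hT.ne' hk.ne'] at hL ⊢
  rw [Real.log_div hT.ne' hs.ne']
  nlinarith [mul_le_mul_of_nonneg_left hL h5]

end TimeMesh

/-! ### Implicit Euler schemes with time-dependent symmetric operators -/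

section Scheme

variable {V : Type*} [NormedAddCommGroup V] [InnerProductSpace ℝ V] {T : ℝ}
  {Δ : TimeMesh T} {A : ℕ → V →ₗ[ℝ] V} {v F : ℕ → V}

/-- Stability in L²: pair the scheme with v_m and drop the nonnegative energy term. -/
theorem norm_le_sum_of_scheme
    (hA0 : ∀ m ∈ Finset.Icc 1 Δ.M, ∀ x, 0 ≤ ⟪A m x, x⟫_ℝ) (hv0 : v 0 = 0)
    (hv : ∀ m ∈ Finset.Icc 1 Δ.M, v m + Δ.step m • A m (v m) = v (m - 1) + F m)
    {n : ℕ} (hn : n ≤ Δ.M) : ‖v n‖ ≤ ∑ m ∈ Finset.Icc 1 n, ‖F m‖ := by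
  induction n with
  | zero => simp [hv0]
  | succ n ih =>
    have hm : n + 1 ∈ Finset.Icc 1 Δ.M := by simp only [Finset.mem_Icc]; omega
    rw [Finset.sum_Icc_succ_top (by omega)]
    have h1 := hv _ hm
    rw [Nat.add_sub_cancel] at h1
    have h2 := congrArg (fun z => ⟪z, v (n + 1)⟫_ℝ) h1
    simp only [inner_add_left, real_inner_smul_left, real_inner_self_eq_norm_sq] at h2
    have h3 := mul_nonneg (Δ.step_pos (m := n + 1) (by omega) hn).le (hA0 _ hm (v (n + 1)))
    have h4 := real_inner_le_norm (v n) (v (n + 1))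
    have h5 := real_inner_le_norm (F (n + 1)) (v (n + 1))
    have h6 := ih (by omega)
    have h7 : ‖v (n + 1)‖ * ‖v (n + 1)‖ ≤ (‖v n‖ + ‖F (n + 1)‖) * ‖v (n + 1)‖ := by nlinarith
    rcases eq_or_lt_of_le (norm_nonneg (v (n + 1))) with h0 | h0
    · rw [← h0]
      positivity
    · linarith [le_of_mul_le_mul_right h7 h0]

theorem energy_le_of_scheme
    (hA0 : ∀ m ∈ Finset.Icc 1 Δ.M, ∀ x, 0 ≤ ⟪A m x, x⟫_ℝ) (hv0 : v 0 = 0)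
    (hv : ∀ m ∈ Finset.Icc 1 Δ.M, v m + Δ.step m • A m (v m) = v (m - 1) + F m) :
    ∑ m ∈ Finset.Icc 1 Δ.M, Δ.step m * ⟪A m (v m), v m⟫_ℝ
      ≤ (∑ m ∈ Finset.Icc 1 Δ.M, ‖F m‖) ^ 2 := by
  set G := ∑ m ∈ Finset.Icc 1 Δ.M, ‖F m‖ with hG
  -- Pairing with v_m again, now keeping the energy; ⟪F_m, v_m⟫ ≤ G ‖F_m‖ by the stability bound,
  -- and the squares of ‖v_m‖ telescope.
  have key : ∀ n ≤ Δ.M, ∑ m ∈ Finset.Icc 1 n, Δ.step m * ⟪A m (v m), v m⟫_ℝ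
      ≤ G * ∑ m ∈ Finset.Icc 1 n, ‖F m‖ - ‖v n‖ ^ 2 / 2 := by
    intro n
    induction n with
    | zero => simp [hv0]
    | succ n ih =>
      intro hn
      have hm : n + 1 ∈ Finset.Icc 1 Δ.M := by simp only [Finset.mem_Icc]; omega
      rw [Finset.sum_Icc_succ_top (by omega), Finset.sum_Icc_succ_top (by omega)]
      have h1 := hv _ hm
      rw [Nat.add_sub_cancel] at h1
      have h2 := congrArg (fun z => ⟪z, v (n + 1)⟫_ℝ) h1
      simp only [inner_add_left, real_inner_smul_left, real_inner_self_eq_norm_sq] at h2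
      have h4 := real_inner_le_norm (v n) (v (n + 1))
      have h5 := real_inner_le_norm (F (n + 1)) (v (n + 1))
      have h6 : ‖v (n + 1)‖ ≤ G := (norm_le_sum_of_scheme hA0 hv0 hv hn).trans
        (Finset.sum_le_sum_of_subset_of_nonneg (Finset.Icc_subset_Icc le_rfl hn)
          fun _ _ _ => norm_nonneg _)
      have h7 := mul_le_mul_of_nonneg_left h6 (norm_nonneg (F (n + 1)))
      have h8 := ih (by omega)
      nlinarith [sq_nonneg (‖v n‖ - ‖v (n + 1)‖)]
  have := key Δ.M le_rfl
  rw [← hG] at this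
  nlinarith [sq_nonneg ‖v Δ.M‖]

/-- Cauchy–Schwarz in time with ∑ k_m = T turns the L² in time energy bound into an L¹ in time
bound, linear in the data. -/
theorem sum_step_mul_le_of_scheme (hT : 0 < T) {N : V → ℝ} {γ : ℝ} (hγ : 0 < γ)
    (hN : ∀ m ∈ Finset.Icc 1 Δ.M, ∀ x, γ * N x ^ 2 ≤ ⟪A m x, x⟫_ℝ) (hv0 : v 0 = 0)
    (hv : ∀ m ∈ Finset.Icc 1 Δ.M, v m + Δ.step m • A m (v m) = v (m - 1) + F m) :
    ∑ m ∈ Finset.Icc 1 Δ.M, Δ.step m * N (v m)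
      ≤ √(T / γ) * ∑ m ∈ Finset.Icc 1 Δ.M, ‖F m‖ := by
  have hpos : ∀ m ∈ Finset.Icc 1 Δ.M, 0 ≤ Δ.step m := fun m hm => by
    rw [Finset.mem_Icc] at hm
    exact (Δ.step_pos hm.1 hm.2).le
  have hE := energy_le_of_scheme (fun m hm x => le_trans (by positivity) (hN m hm x)) hv0 hv
  have hG : 0 ≤ ∑ m ∈ Finset.Icc 1 Δ.M, ‖F m‖ := Finset.sum_nonneg fun _ _ => norm_nonneg _
  refine le_of_sq_le_sq ?_ (by positivity)
  have hsum : ∑ m ∈ Finset.Icc 1 Δ.M, Δ.step m = T := by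
    rw [Δ.sum_step (Δ.M_pos hT), Δ.t_last, Nat.sub_self, Δ.t_zero, sub_zero]
  have hCS := Finset.sum_sq_le_sum_mul_sum_of_sq_le_mul (Finset.Icc 1 Δ.M)
    (r := fun m => Δ.step m * N (v m)) (f := Δ.step) (g := fun m => Δ.step m * N (v m) ^ 2)
    hpos (fun m hm => mul_nonneg (hpos m hm) (sq_nonneg _)) (fun m _ => (by ring : _ = _).le)
  rw [hsum] at hCS
  have h1 : γ * ∑ m ∈ Finset.Icc 1 Δ.M, Δ.step m * N (v m) ^ 2
      ≤ (∑ m ∈ Finset.Icc 1 Δ.M, ‖F m‖) ^ 2 := by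
    refine le_trans ?_ hE
    rw [Finset.mul_sum]
    refine Finset.sum_le_sum fun m hm => ?_
    nlinarith [mul_le_mul_of_nonneg_left (hN m hm (v m)) (hpos m hm)]
  rw [mul_pow, Real.sq_sqrt (by positivity), div_mul_eq_mul_div, le_div_iff₀ hγ]
  nlinarith [mul_le_mul_of_nonneg_left h1 hT.le]

/-- Duhamel's formula for the operator frozen on the last interval. -/
theorem scheme_duhamel {ι : Type*} [Fintype ι] (b : OrthonormalBasis ι ℝ V) {n : ℕ}
    (hn : n ∈ Finset.Icc 1 Δ.M) (hA : (A n).IsSymmetric) (lam : ι → ℝ)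
    (hlam : ∀ i, A n (b i) = lam i • b i) (hlam0 : ∀ i, 0 ≤ lam i) (hv0 : v 0 = 0)
    (hv : ∀ m ∈ Finset.Icc 1 Δ.M, v m + Δ.step m • A m (v m) = v (m - 1) + F m) :
    A n (v n) = ∑ m ∈ Finset.Icc 1 n,
      (diagOp b (fun i => lam i * (∏ j ∈ Finset.Icc m n, (1 + Δ.step j * lam i))⁻¹) (F m) +
        Δ.step m • diagOp b (fun i => lam i * (∏ j ∈ Finset.Icc m n, (1 + Δ.step j * lam i))⁻¹)
          (A n (v m) - A m (v m))) := by
  rw [Finset.mem_Icc] at hn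
  refine b.repr.injective (PiLp.ext fun i => ?_)
  rw [b.repr_apply_apply, b.repr_apply_apply]
  have hAi : ∀ x, ⟪b i, A n x⟫_ℝ = lam i * ⟪b i, x⟫_ℝ := fun x => by
    rw [← hA (b i) x, hlam, real_inner_smul_left]
  -- The scheme rewritten as v_m + k_m A_n v_m = v_{m-1} + F_m + k_m (A_n - A_m) v_m decouples in
  -- the eigenbasis of A_n.
  have hrec := recursion_solution (fun m => Δ.step m * lam i) (fun m => ⟪b i, v m⟫_ℝ)
    (fun m => ⟪b i, F m⟫_ℝ + Δ.step m * ⟪b i, A n (v m) - A m (v m)⟫_ℝ) n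
    (fun m hm => by
      rw [Finset.mem_Icc] at hm
      exact mul_nonneg (Δ.step_pos hm.1 (by omega)).le (hlam0 i))
    (by simp [hv0])
    (fun m hm => by
      rw [Finset.mem_Icc] at hm
      have h1 := congrArg (fun z => ⟪b i, z⟫_ℝ)
        (hv m (by simp only [Finset.mem_Icc]; omega))
      simp only [inner_add_right, real_inner_smul_right] at h1
      simp only [inner_sub_right, hAi]
      linarith)
  rw [hAi, hrec, inner_sum, Finset.mul_sum]
  refine Finset.sum_congr rfl fun m _ => ?_
  rw [inner_add_right, real_inner_smul_right, inner_diagOp, inner_diagOp]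
  ring

theorem norm_operator_le_of_scheme [FiniteDimensional ℝ V] {c β κ : ℝ} (hreg : Δ.IsRegular c β κ)
    (hκ : 0 < κ) {n : ℕ} (hn : n ∈ Finset.Icc 1 Δ.M) (hA : (A n).IsSymmetric) {N : V → ℝ}
    (hNn : ∀ x, 0 ≤ N x) {γ : ℝ} (hγ : 0 < γ) (hN : ∀ x, γ * N x ^ 2 ≤ ⟪A n x, x⟫_ℝ)
    {ω : ℝ → ℝ} (hω0 : ∀ s ∈ Icc 0 T, 0 ≤ ω s)
    (hω : ∀ m ∈ Finset.Icc 1 n, ∀ u x,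
      |⟪A n u - A m u, x⟫_ℝ| ≤ ω (Δ.t n - Δ.t (m - 1)) * N u * N x)
    (hv0 : v 0 = 0)
    (hv : ∀ m ∈ Finset.Icc 1 Δ.M, v m + Δ.step m • A m (v m) = v (m - 1) + F m) :
    ‖A n (v n)‖ ≤ ∑ m ∈ Finset.Icc 1 n, (Δ.t n - Δ.t (m - 1))⁻¹ * ‖F m‖ +
      √(2 * (1 + κ) / γ) * ∑ m ∈ Finset.Ico 1 n, Δ.step m *
        (ω (Δ.t n - Δ.t (m - 1)) / (Δ.t n - Δ.t (m - 1)) ^ (3 / 2 : ℝ)) * N (v m) := by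
  have hn' := Finset.mem_Icc.1 hn
  set b := hA.eigenvectorBasis rfl
  set lam := hA.eigenvalues rfl
  have hlam : ∀ i, A n (b i) = lam i • b i := fun i => hA.apply_eigenvectorBasis rfl i
  have hlam0 : ∀ i, 0 ≤ lam i := fun i => by
    have h1 := hN (b i)
    rw [hlam, real_inner_smul_left, real_inner_self_eq_norm_sq, b.norm_eq_one] at h1
    nlinarith [mul_nonneg hγ.le (sq_nonneg (N (b i)))]
  rw [scheme_duhamel b hn hA lam hlam hlam0 hv0 hv, Finset.sum_add_distrib]
  refine (norm_add_le _ _).trans (add_le_add ?_ ?_)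
  · refine (norm_sum_le _ _).trans (Finset.sum_le_sum fun m hm => ?_)
    rw [Finset.mem_Icc] at hm
    exact norm_diagOp_le b _ _ (inv_nonneg.2 (Δ.t_sub_pos hm.1 hm.2 hn'.2).le)
      (fun i => Δ.resolvent_symbol_le hm.1 hm.2 hn'.2 (hlam0 i)) _
  -- The perturbation vanishes for m = n, the one case in which R is a single factor and the
  -- S^{-3/2} smoothing fails.
  · rw [← Finset.Ico_insert_right hn'.1, Finset.sum_insert (by simp), sub_self]
    have h0 : ∀ c, diagOp b c (0 : V) = 0 := fun c => by simp [diagOp]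
    rw [h0, smul_zero, zero_add, Finset.mul_sum]
    refine (norm_sum_le _ _).trans (Finset.sum_le_sum fun m hm => ?_)
    rw [Finset.mem_Ico] at hm
    have hS := Δ.t_sub_pos hm.1 hm.2.le hn'.2
    have hk := Δ.step_pos hm.1 (by omega)
    have hωS := hω0 (Δ.t n - Δ.t (m - 1)) ⟨hS.le, by
      linarith [Δ.t_le hn'.2, Δ.t_nonneg (m := m - 1) (by omega)]⟩
    have hmain := sq_norm_diagOp_le b (A n) hA lam hlam N γ hγ hN (A n (v m) - A m (v m))
      (ω (Δ.t n - Δ.t (m - 1)) * N (v m))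
      (fun x => hω m (by simp only [Finset.mem_Icc]; omega) (v m) x)
      (fun i => lam i * (∏ j ∈ Finset.Icc m n, (1 + Δ.step j * lam i))⁻¹)
      (2 * (1 + κ) / (Δ.t n - Δ.t (m - 1)) ^ 3) (by positivity)
      (fun i => hreg.resolvent_symbol_cube_le hκ hm.1 hm.2 hn'.2 (hlam0 i))
    set S := Δ.t n - Δ.t (m - 1)
    rw [norm_smul, Real.norm_of_nonneg hk.le]
    have h1 : ‖diagOp b (fun i => lam i * (∏ j ∈ Finset.Icc m n, (1 + Δ.step j * lam i))⁻¹)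
        (A n (v m) - A m (v m))‖ ≤ √(2 * (1 + κ) / γ) * (ω S / S ^ (3 / 2 : ℝ)) * N (v m) := by
      have hNm := hNn (v m)
      refine le_of_sq_le_sq ?_ (by positivity)
      have h2 : (S ^ (3 / 2 : ℝ)) ^ 2 = S ^ 3 := by
        rw [← Real.rpow_natCast, ← Real.rpow_mul hS.le, ← Real.rpow_natCast]
        norm_num
      rw [mul_pow, mul_pow, div_pow, h2, Real.sq_sqrt (by positivity)]
      have h3 : 2 * (1 + κ) / γ * (ω S ^ 2 / S ^ 3) * N (v m) ^ 2
          = (ω S * N (v m)) ^ 2 * (2 * (1 + κ) / S ^ 3) / γ := by ring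
      rw [h3, le_div_iff₀ hγ, mul_comm]
      exact hmain
    calc _ ≤ Δ.step m * (√(2 * (1 + κ) / γ) * (ω S / S ^ (3 / 2 : ℝ)) * N (v m)) :=
          mul_le_mul_of_nonneg_left h1 hk.le
      _ = _ := by ring

/-- Discrete maximal regularity in `L¹` for the implicit Euler scheme with time-dependent forms. -/
theorem sum_norm_operator_le_of_scheme [FiniteDimensional ℝ V] (hT : 0 < T) {c β κ : ℝ}
    (hreg : Δ.IsRegular c β κ) (hc : 0 < c) (hκ : 0 < κ)
    (hA : ∀ n ∈ Finset.Icc 1 Δ.M, (A n).IsSymmetric) {N : V → ℝ}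
    (hNn : ∀ x, 0 ≤ N x) {γ : ℝ} (hγ : 0 < γ)
    (hN : ∀ n ∈ Finset.Icc 1 Δ.M, ∀ x, γ * N x ^ 2 ≤ ⟪A n x, x⟫_ℝ)
    {ω : ℝ → ℝ} (hω0 : ∀ s ∈ Icc 0 T, 0 ≤ ω s)
    (hanti : AntitoneOn (fun s => ω s / s ^ (3 / 2 : ℝ)) (Ioc 0 T))
    (hint : IntegrableOn (fun s => ω s / s ^ (3 / 2 : ℝ)) (Ioc 0 T))
    (hω : ∀ n ∈ Finset.Icc 1 Δ.M, ∀ m ∈ Finset.Icc 1 n, ∀ u x,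
      |⟪A n u - A m u, x⟫_ℝ| ≤ ω (Δ.t n - Δ.t (m - 1)) * N u * N x)
    (hv0 : v 0 = 0)
    (hv : ∀ m ∈ Finset.Icc 1 Δ.M, v m + Δ.step m • A m (v m) = v (m - 1) + F m) :
    ∑ n ∈ Finset.Icc 1 Δ.M, Δ.step n * ‖A n (v n)‖ ≤
      (1 + |Real.log (T / (c * T ^ β))| + β + √(2 * (1 + κ) / γ) * √(T / γ) *
        ∫ s in Ioc 0 T, ω s / s ^ (3 / 2 : ℝ)) * Real.log (T / Δ.kmax) *
        ∑ m ∈ Finset.Icc 1 Δ.M, ‖F m‖ := by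
  set h : ℝ → ℝ := fun s => ω s / s ^ (3 / 2 : ℝ) with hh
  set L := Real.log (T / Δ.kmax) with hL
  set W := ∫ s in Ioc 0 T, h s with hW
  have hnn : ∀ s ∈ Ioc 0 T, 0 ≤ h s := fun s hs =>
    div_nonneg (hω0 s ⟨hs.1.le, hs.2⟩) (Real.rpow_nonneg hs.1.le _)
  have hW0 : 0 ≤ W := setIntegral_nonneg measurableSet_Ioc hnn
  have hL1 : 1 ≤ L := (hreg.one_add_log_le hT hc le_rfl (Δ.M_pos hT)).2
  set G := ∑ m ∈ Finset.Icc 1 Δ.M, ‖F m‖ with hG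
  have hG0 : 0 ≤ G := Finset.sum_nonneg fun _ _ => norm_nonneg _
  -- Exchanging the order of summation leaves, for fixed m, a sum over n ≥ m that depends on the
  -- mesh alone.
  have hswap : ∀ g : ℕ → ℕ → ℝ, ∑ n ∈ Finset.Icc 1 Δ.M, ∑ m ∈ Finset.Icc 1 n, g n m
      = ∑ m ∈ Finset.Icc 1 Δ.M, ∑ n ∈ Finset.Icc m Δ.M, g n m := fun g =>
    Finset.sum_comm' fun n m => by simp only [Finset.mem_Icc]; omega
  have hswap' : ∀ g : ℕ → ℕ → ℝ, ∑ n ∈ Finset.Icc 1 Δ.M, ∑ m ∈ Finset.Ico 1 n, g n m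
      = ∑ m ∈ Finset.Icc 1 Δ.M, ∑ n ∈ Finset.Icc (m + 1) Δ.M, g n m := fun g =>
    Finset.sum_comm' fun n m => by simp only [Finset.mem_Icc, Finset.mem_Ico]; omega
  have hfirst : ∑ n ∈ Finset.Icc 1 Δ.M, ∑ m ∈ Finset.Icc 1 n,
      Δ.step n * (Δ.t n - Δ.t (m - 1))⁻¹ * ‖F m‖
        ≤ (1 + |Real.log (T / (c * T ^ β))| + β) * L * G := by
    rw [hswap, hG, Finset.mul_sum]
    refine Finset.sum_le_sum fun m hm => ?_
    rw [Finset.mem_Icc] at hm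
    rw [← Finset.sum_mul]
    refine mul_le_mul_of_nonneg_right ?_ (norm_nonneg _)
    refine ((Δ.sum_step_div_le hm.1 hm.2 le_rfl).trans ?_).trans
      (hreg.one_add_log_le hT hc hm.1 hm.2).1
    have hk := Δ.step_pos hm.1 hm.2
    have hS := Δ.t_sub_pos hm.1 hm.2 le_rfl
    have := Δ.t_nonneg (m := m - 1) (by omega)
    rw [Δ.t_last] at hS ⊢
    gcongr
    linarith
  have hsecond : ∑ n ∈ Finset.Icc 1 Δ.M, ∑ m ∈ Finset.Ico 1 n,
      Δ.step n * h (Δ.t n - Δ.t (m - 1)) * (Δ.step m * N (v m)) ≤ W * (√(T / γ) * G) := by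
    rw [hswap']
    calc _ ≤ ∑ m ∈ Finset.Icc 1 Δ.M, W * (Δ.step m * N (v m)) := by
          refine Finset.sum_le_sum fun m hm => ?_
          rw [Finset.mem_Icc] at hm
          rw [← Finset.sum_mul]
          exact mul_le_mul_of_nonneg_right (Δ.sum_step_mul_antitone_le hanti hnn hint hm.1 hm.2)
            (mul_nonneg (Δ.step_pos hm.1 hm.2).le (hNn _))
      _ ≤ _ := by
          rw [← Finset.mul_sum]
          exact mul_le_mul_of_nonneg_left (sum_step_mul_le_of_scheme hT hγ hN hv0 hv) hW0
  calc _ ≤ ∑ n ∈ Finset.Icc 1 Δ.M, (∑ m ∈ Finset.Icc 1 n,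
        Δ.step n * (Δ.t n - Δ.t (m - 1))⁻¹ * ‖F m‖ + √(2 * (1 + κ) / γ) * ∑ m ∈ Finset.Ico 1 n,
          Δ.step n * h (Δ.t n - Δ.t (m - 1)) * (Δ.step m * N (v m))) := by
        refine Finset.sum_le_sum fun n hn => ?_
        have hn' := Finset.mem_Icc.1 hn
        refine (mul_le_mul_of_nonneg_left (norm_operator_le_of_scheme hreg hκ hn (hA n hn) hNn hγ
          (hN n hn) hω0 (hω n hn) hv0 hv) (Δ.step_pos hn'.1 hn'.2).le).trans_eq ?_
        rw [mul_add, Finset.mul_sum, Finset.mul_sum, Finset.mul_sum, Finset.mul_sum]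
        congr 1
        · exact Finset.sum_congr rfl fun m _ => by ring
        · exact Finset.sum_congr rfl fun m _ => by ring
    _ ≤ (1 + |Real.log (T / (c * T ^ β))| + β) * L * G
          + √(2 * (1 + κ) / γ) * (W * (√(T / γ) * G)) := by
        rw [Finset.sum_add_distrib, ← Finset.mul_sum]
        exact add_le_add hfirst (mul_le_mul_of_nonneg_left hsecond (Real.sqrt_nonneg _))
    _ ≤ _ := by
        have : 0 ≤ √(2 * (1 + κ) / γ) * √(T / γ) * W * G := by positivity
        nlinarith [mul_le_mul_of_nonneg_left hL1 this]

end Scheme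

/-! ### Weak derivatives of functions in `H¹₀` -/

section Sobolev

variable {d : ℕ} {Ω : Set (E d)}

theorem IsTestFunction.pderiv {φ : E d → ℝ} (hφ : IsTestFunction Ω φ) (i : Fin d) :
    IsTestFunction Ω (pderiv i φ) where
  smooth := (hφ.smooth.fderiv_right (m := (⊤ : ℕ∞)) (by simp)).clm_apply contDiff_const
  compact := hφ.compact.fderiv_apply ℝ _
  support := (tsupport_fderiv_apply_subset ℝ _).trans hφ.support

theorem IsTestFunction.memLp {φ : E d → ℝ} (hφ : IsTestFunction Ω φ) :
    MemLp φ 2 (volume.restrict Ω) :=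
  (hφ.smooth.continuous.memLp_of_hasCompactSupport hφ.compact).restrict Ω

/-- A test function as an element of `L²(Ω)`. -/
noncomputable def IsTestFunction.toL2 {φ : E d → ℝ} (hφ : IsTestFunction Ω φ) : L2 Ω :=
  hφ.memLp.toLp φ

theorem IsTestFunction.inner_toL2 {φ : E d → ℝ} (hφ : IsTestFunction Ω φ) (v : L2 Ω) :
    ⟪hφ.toL2, v⟫_ℝ = ∫ x in Ω, v x * φ x := by
  rw [L2.inner_def]
  refine integral_congr_ae ?_
  filter_upwards [hφ.memLp.coeFn_toLp] with x hx
  rw [IsTestFunction.toL2, hx]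
  rfl

/-- As an identity between L² inner products, the weak derivative is visibly linear and stable under
L² limits. -/
theorem hasWeakPartial_iff {i : Fin d} {v g : L2 Ω} :
    HasWeakPartial Ω i v g ↔ ∀ (φ : E d → ℝ) (hφ : IsTestFunction Ω φ),
      ⟪(hφ.pderiv i).toL2, v⟫_ℝ = -⟪hφ.toL2, g⟫_ℝ := by
  refine forall_congr' fun φ => forall_congr' fun hφ => ?_
  rw [IsTestFunction.inner_toL2, IsTestFunction.inner_toL2]

theorem HasWeakPartial.add {i : Fin d} {u v g h : L2 Ω} (hu : HasWeakPartial Ω i u g)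
    (hv : HasWeakPartial Ω i v h) : HasWeakPartial Ω i (u + v) (g + h) := by
  rw [hasWeakPartial_iff] at *
  intro φ hφ
  rw [inner_add_right, inner_add_right, hu φ hφ, hv φ hφ, neg_add]

theorem HasWeakPartial.smul {i : Fin d} {u g : L2 Ω} (c : ℝ) (hu : HasWeakPartial Ω i u g) :
    HasWeakPartial Ω i (c • u) (c • g) := by
  rw [hasWeakPartial_iff] at *
  intro φ hφ
  rw [real_inner_smul_right, real_inner_smul_right, hu φ hφ, mul_neg]

theorem isClosed_hasWeakPartial (i : Fin d) :
    IsClosed {p : L2 Ω × (Fin d → L2 Ω) | HasWeakPartial Ω i p.1 (p.2 i)} := by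
  simp only [hasWeakPartial_iff, ofPred_forall]
  refine isClosed_iInter fun φ => isClosed_iInter fun hφ => ?_
  exact isClosed_eq (by fun_prop) (by fun_prop)

/-- Both functions are supported in Ω, so the integrals extend to the whole space, where integration
by parts has no boundary term. -/
theorem hasWeakPartial_of_mem_testPairs {p : L2 Ω × (Fin d → L2 Ω)} (hp : p ∈ testPairs Ω)
    (i : Fin d) : HasWeakPartial Ω i p.1 (p.2 i) := by
  obtain ⟨φ, hφ, h1, h2⟩ := hp
  intro ψ hψ
  have e1 : ∫ x in Ω, p.1 x * pderiv i ψ x = ∫ x, φ x * pderiv i ψ x := by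
    rw [← setIntegral_eq_integral_of_forall_compl_eq_zero (s := Ω)
      (f := fun x => φ x * pderiv i ψ x) (fun x hx => by
      rw [image_eq_zero_of_notMem_tsupport fun h => hx (hφ.support h), zero_mul])]
    refine integral_congr_ae ?_
    filter_upwards [h1] with x hx
    rw [hx]
  have e2 : ∫ x in Ω, p.2 i x * ψ x = ∫ x, pderiv i φ x * ψ x := by
    rw [← setIntegral_eq_integral_of_forall_compl_eq_zero (s := Ω)
      (f := fun x => pderiv i φ x * ψ x) (fun x hx => by
      rw [image_eq_zero_of_notMem_tsupport fun h => hx (hψ.support h), mul_zero])]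
    refine integral_congr_ae ?_
    filter_upwards [h2 i] with x hx
    rw [hx]
  rw [e1, e2]
  have hint : ∀ {f g : E d → ℝ}, IsTestFunction Ω f → IsTestFunction Ω g →
      Integrable (fun x => f x * g x) := fun hf hg =>
    (hf.smooth.continuous.mul hg.smooth.continuous).integrable_of_hasCompactSupport
      hf.compact.mul_right
  exact integral_mul_fderiv_eq_neg_fderiv_mul_of_integrable (hint (hφ.pderiv i) hψ)
    (hint hφ (hψ.pderiv i)) (hint hφ hψ)
    (fun x _ => (hφ.smooth.differentiable (by simp)) x)
    (fun x _ => (hψ.smooth.differentiable (by simp)) x)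

theorem exists_hasWeakPartial {v : L2 Ω} (hv : v ∈ H10 Ω) (i : Fin d) :
    ∃ g : L2 Ω, HasWeakPartial Ω i v g := by
  obtain ⟨p, hp, rfl⟩ := hv
  refine ⟨p.2 i, ?_⟩
  have hp' : p ∈ closure (testPairs Ω : Set (L2 Ω × (Fin d → L2 Ω))) := hp
  exact closure_minimal (fun q hq => hasWeakPartial_of_mem_testPairs hq i)
    (isClosed_hasWeakPartial i) hp'

theorem hasWeakPartial_weakPartial {v : L2 Ω} (hv : v ∈ H10 Ω) (i : Fin d) :
    HasWeakPartial Ω i v (weakPartial i v) := by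
  rw [weakPartial, dif_pos (exists_hasWeakPartial hv i)]
  exact (exists_hasWeakPartial hv i).choose_spec

theorem isFiniteMeasure_restrict_of_isBounded (hΩb : Bornology.IsBounded Ω) :
    IsFiniteMeasure (volume.restrict Ω) :=
  isFiniteMeasure_restrict.2 hΩb.measure_lt_top.ne

/-- The fundamental lemma of the calculus of variations; boundedness of Ω puts L² inside L¹.
Uniqueness is what makes the chosen `weakPartial` linear on H¹₀. -/
theorem HasWeakPartial.unique (hΩ : IsOpen Ω) (hΩb : Bornology.IsBounded Ω) {i : Fin d}
    {v g h : L2 Ω} (hg : HasWeakPartial Ω i v g) (hh : HasWeakPartial Ω i v h) : g = h := by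
  have := isFiniteMeasure_restrict_of_isBounded hΩb
  rw [← sub_eq_zero]
  have hint : IntegrableOn (g - h : L2 Ω) Ω := (Lp.memLp (g - h)).integrable (by norm_num)
  have key := hΩ.ae_eq_zero_of_integral_contDiff_smul_eq_zero hint.locallyIntegrableOn
    (fun φ h1 h2 h3 => by
      have hφ : IsTestFunction Ω φ := ⟨h1, h2, h3⟩
      rw [← setIntegral_eq_integral_of_forall_compl_eq_zero (s := Ω) (fun x hx => by
        rw [image_eq_zero_of_notMem_tsupport fun h => hx (h3 h), zero_smul])]
      have e := hφ.inner_toL2 (g - h)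
      rw [hasWeakPartial_iff] at hg hh
      rw [inner_sub_right, ← neg_inj.2 (hg φ hφ) |>.trans (neg_neg _) ] at e
      rw [← neg_inj.2 (hh φ hφ) |>.trans (neg_neg _), sub_self] at e
      rw [e]
      exact integral_congr_ae (Filter.Eventually.of_forall fun x => mul_comm _ _))
  rw [Lp.eq_zero_iff_ae_eq_zero]
  exact (ae_restrict_iff' hΩ.measurableSet).2 key

theorem weakPartial_add (hΩ : IsOpen Ω) (hΩb : Bornology.IsBounded Ω) {u v : L2 Ω}
    (hu : u ∈ H10 Ω) (hv : v ∈ H10 Ω) (i : Fin d) :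
    weakPartial i (u + v) = weakPartial i u + weakPartial i v :=
  (hasWeakPartial_weakPartial (add_mem hu hv) i).unique hΩ hΩb
    ((hasWeakPartial_weakPartial hu i).add (hasWeakPartial_weakPartial hv i))

theorem weakPartial_smul (hΩ : IsOpen Ω) (hΩb : Bornology.IsBounded Ω) (c : ℝ) {u : L2 Ω}
    (hu : u ∈ H10 Ω) (i : Fin d) : weakPartial i (c • u) = c • weakPartial i u :=
  (hasWeakPartial_weakPartial (Submodule.smul_mem _ c hu) i).unique hΩ hΩb
    ((hasWeakPartial_weakPartial hu i).smul c)

end Sobolev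

/-! ### Finite dimension of the finite element spaces -/

section FiniteDimensional

variable {d : ℕ} {Ω : Set (E d)}

/-- The `d`-dimensional simplices of a triangulation. -/
abbrev Triangulation.Cell (𝒯 : Triangulation Ω) : Type :=
  {τ : Finset (E d) // τ ∈ 𝒯.faces ∧ τ.card = d + 1}

instance (𝒯 : Triangulation Ω) : Finite 𝒯.Cell :=
  (𝒯.finite.subset fun _ h => h.1 : {τ | τ ∈ 𝒯.faces ∧ τ.card = d + 1}.Finite).to_subtype

/-- Pairs of a piecewise polynomial and an `L²` function that it represents. -/
def Triangulation.piecewisePairs (𝒯 : Triangulation Ω) (r : ℕ) :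
    Submodule ℝ ((𝒯.Cell → MvPolynomial.restrictTotalDegree (Fin d) ℝ r) × L2 Ω) where
  carrier := {q | ∀ τ : 𝒯.Cell, ∀ᵐ x ∂volume.restrict Ω,
    x ∈ convexHull ℝ (τ.1 : Set (E d)) →
      q.2 x = MvPolynomial.eval (fun i => x i) (q.1 τ : MvPolynomial (Fin d) ℝ)}
  zero_mem' := fun τ => by
    filter_upwards [Lp.coeFn_zero ℝ 2 (volume.restrict Ω)] with x hx _
    simpa using hx
  add_mem' := by
    intro p q hp hq τ
    filter_upwards [Lp.coeFn_add p.2 q.2, hp τ, hq τ] with x hx h1 h2 hxτ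
    simp only [Prod.snd_add, Prod.fst_add, Pi.add_apply, Submodule.coe_add, map_add, hx, h1 hxτ,
      h2 hxτ]
  smul_mem' := by
    intro c p hp τ
    filter_upwards [Lp.coeFn_smul c p.2, hp τ] with x hx h1 hxτ
    simp only [Prod.smul_snd, Prod.smul_fst, Pi.smul_apply, Submodule.coe_smul,
      MvPolynomial.smul_eval, hx, h1 hxτ, smul_eq_mul]

theorem Triangulation.exists_cell (𝒯 : Triangulation Ω) {x : E d} (hx : x ∈ Ω) :
    ∃ τ : 𝒯.Cell, x ∈ convexHull ℝ (τ.1 : Set (E d)) := by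
  have h : x ∈ 𝒯.space := 𝒯.space_eq ▸ subset_closure hx
  obtain ⟨s, hs, hxs⟩ := Geometry.SimplicialComplex.mem_space_iff.1 h
  obtain ⟨τ, hτ, hsτ, hc⟩ := 𝒯.pure s hs
  exact ⟨⟨τ, hτ, hc⟩, convexHull_mono (Finset.coe_subset.2 hsτ) hxs⟩

/-- The cells cover Ω, so the polynomials of a pair determine its function and the pairs form a
finite-dimensional space, whose second projection contains the finite element space. Using pairs
avoids choosing the polynomials linearly in the function. -/
theorem finiteDimensional_feSpace (hΩ : IsOpen Ω) (𝒯 : Triangulation Ω) (r : ℕ) :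
    FiniteDimensional ℝ (feSpace 𝒯 r) := by
  have hinj : Function.Injective ((LinearMap.fst ℝ
      (𝒯.Cell → MvPolynomial.restrictTotalDegree (Fin d) ℝ r) (L2 Ω)).comp
        (𝒯.piecewisePairs r).subtype) := by
    rw [injective_iff_map_eq_zero]
    rintro ⟨q, hq⟩ h0
    have h0' : q.1 = 0 := h0
    have h2 : q.2 = 0 := by
      rw [Lp.eq_zero_iff_ae_eq_zero]
      have hall := ae_all_iff.2 hq
      filter_upwards [hall, ae_restrict_mem hΩ.measurableSet] with x hx hxΩ
      obtain ⟨τ, hτ⟩ := 𝒯.exists_cell hxΩ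
      simpa [h0'] using hx τ hτ
    exact Subtype.ext (Prod.ext h0' h2)
  have hfd : FiniteDimensional ℝ (𝒯.piecewisePairs r) := Module.Finite.of_injective _ hinj
  have hle : feSpace 𝒯 r ≤ (𝒯.piecewisePairs r).map
      (LinearMap.snd ℝ (𝒯.Cell → MvPolynomial.restrictTotalDegree (Fin d) ℝ r) (L2 Ω)) := by
    rintro v ⟨-, hv⟩
    choose p hp hpv using hv
    exact ⟨⟨fun τ => ⟨p τ.1 τ.2.1 τ.2.2, (MvPolynomial.mem_restrictTotalDegree _ _ _).2 (hp _ _ _)⟩,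
      v⟩, fun τ => hpv τ.1 τ.2.1 τ.2.2, rfl⟩
  exact Submodule.finiteDimensional_of_le hle

end FiniteDimensional

/-! ### The elliptic form at almost every time -/

section Form

variable {d : ℕ} {Ω : Set (E d)} {T : ℝ} {a : Fin d → Fin d → ℝ → E d → ℝ} {α : ℝ} {ω : ℝ → ℝ}

/-- The coefficients at time `s` are bounded, symmetric and elliptic. -/
structure IsEllipticAt (Ω : Set (E d)) (a : Fin d → Fin d → ℝ → E d → ℝ) (α s : ℝ) : Prop where
  memLp : ∀ i j, MemLp (a i j s) ∞ (volume.restrict Ω)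
  symm : ∀ i j, ∀ᵐ x ∂volume.restrict Ω, a i j s x = a j i s x
  elliptic : ∀ᵐ x ∂volume.restrict Ω,
    ∀ ξ : E d, α * ‖ξ‖ ^ 2 ≤ ∑ i, ∑ j, a i j s x * ξ i * ξ j

/-- Fubini: assumptions almost everywhere on the product hold on almost every time slice. -/
theorem IsAdmissible.ae_isEllipticAt (ha : IsAdmissible Ω T a α ω) :
    ∀ᵐ s ∂volume.restrict (Ioc 0 T), IsEllipticAt Ω a α s := by
  rw [← restrict_Ioo_eq_restrict_Ioc]
  have h1 : ∀ i j, ∀ᵐ s ∂volume.restrict (Ioo 0 T), MemLp (a i j s) ∞ (volume.restrict Ω) := by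
    intro i j
    have hb := ae_le_eLpNormEssSup (f := fun p : ℝ × E d => a i j p.1 p.2)
      (μ := (volume.restrict (Ioo 0 T)).prod (volume.restrict Ω))
    filter_upwards [(ha.bounded i j).1.prodMk_left, Measure.ae_ae_of_ae_prod hb] with s h1 h2
    have hlt := (ha.bounded i j).2
    rw [eLpNorm_exponent_top] at hlt
    refine ⟨h1, ?_⟩
    rw [eLpNorm_exponent_top]
    exact (essSup_le_of_ae_le _ h2).trans_lt hlt
  have h2 : ∀ i j, ∀ᵐ s ∂volume.restrict (Ioo 0 T), ∀ᵐ x ∂volume.restrict Ω,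
      a i j s x = a j i s x := fun i j => Measure.ae_ae_of_ae_prod (ha.symm i j)
  filter_upwards [ae_all_iff.2 fun i => ae_all_iff.2 (h1 i), ae_all_iff.2 fun i =>
    ae_all_iff.2 (h2 i), Measure.ae_ae_of_ae_prod ha.elliptic] with s h1 h2 h3
  exact ⟨h1, h2, h3⟩

theorem integrable_mul_L2 (u v : L2 Ω) :
    Integrable (fun x => u x * v x) (volume.restrict Ω) :=
  (Lp.memLp u).integrable_mul (Lp.memLp v)

theorem integrable_coeff_mul {c : E d → ℝ} (hc : MemLp c ∞ (volume.restrict Ω)) (u v : L2 Ω) :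
    Integrable (fun x => c x * u x * v x) (volume.restrict Ω) := by
  simp_rw [mul_assoc]
  exact (integrable_mul_L2 u v).mul_of_top_right hc

theorem IsEllipticAt.form_eq_sum {s : ℝ} (hs : IsEllipticAt Ω a α s) (u v : L2 Ω) :
    form a s u v
      = ∑ i, ∑ j, ∫ x in Ω, a i j s x * weakPartial i u x * weakPartial j v x := by
  rw [form, integral_finsetSum _ fun i _ => integrable_finsetSum _ fun j _ =>
    integrable_coeff_mul (hs.memLp i j) _ _]
  exact Finset.sum_congr rfl fun i _ => integral_finsetSum _ fun j _ =>
    integrable_coeff_mul (hs.memLp i j) _ _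

theorem IsEllipticAt.form_comm {s : ℝ} (hs : IsEllipticAt Ω a α s) (u v : L2 Ω) :
    form a s u v = form a s v u := by
  rw [hs.form_eq_sum, hs.form_eq_sum, Finset.sum_comm]
  refine Finset.sum_congr rfl fun j _ => Finset.sum_congr rfl fun i _ => integral_congr_ae ?_
  filter_upwards [hs.symm i j] with x hx
  rw [hx]
  ring

theorem IsEllipticAt.form_add_right (hΩ : IsOpen Ω) (hΩb : Bornology.IsBounded Ω) {s : ℝ}
    (hs : IsEllipticAt Ω a α s) (u : L2 Ω) {v w : L2 Ω} (hv : v ∈ H10 Ω) (hw : w ∈ H10 Ω) :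
    form a s u (v + w) = form a s u v + form a s u w := by
  simp_rw [hs.form_eq_sum, ← Finset.sum_add_distrib]
  refine Finset.sum_congr rfl fun i _ => Finset.sum_congr rfl fun j _ => ?_
  rw [← integral_add (integrable_coeff_mul (hs.memLp i j) _ _)
    (integrable_coeff_mul (hs.memLp i j) _ _), weakPartial_add hΩ hΩb hv hw]
  refine integral_congr_ae ?_
  filter_upwards [Lp.coeFn_add (weakPartial j v) (weakPartial j w)] with x hx
  rw [hx, Pi.add_apply, mul_add]

theorem IsEllipticAt.form_smul_right (hΩ : IsOpen Ω) (hΩb : Bornology.IsBounded Ω) {s : ℝ}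
    (hs : IsEllipticAt Ω a α s) (u : L2 Ω) (c : ℝ) {v : L2 Ω} (hv : v ∈ H10 Ω) :
    form a s u (c • v) = c * form a s u v := by
  simp_rw [hs.form_eq_sum, Finset.mul_sum]
  refine Finset.sum_congr rfl fun i _ => Finset.sum_congr rfl fun j _ => ?_
  rw [← integral_const_mul, weakPartial_smul hΩ hΩb c hv]
  refine integral_congr_ae ?_
  filter_upwards [Lp.coeFn_smul c (weakPartial j v)] with x hx
  rw [hx, Pi.smul_apply, smul_eq_mul]
  ring

theorem form_zero_right (hΩ : IsOpen Ω) (hΩb : Bornology.IsBounded Ω) (s : ℝ) (u : L2 Ω) :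
    form a s u 0 = 0 := by
  have h0 : ∀ j, weakPartial j (0 : L2 Ω) = 0 := fun j => by
    simpa using weakPartial_smul hΩ hΩb 0 (zero_mem (H10 Ω)) j
  rw [form]
  refine integral_eq_zero_of_ae ?_
  filter_upwards [Lp.coeFn_zero ℝ 2 (volume.restrict Ω)] with x hx
  simp only [h0, hx, Pi.zero_apply, mul_zero, Finset.sum_const_zero]

/-- The sum of the `L²` norms of the partial derivatives. -/
noncomputable def gradNorm (v : L2 Ω) : ℝ := ∑ i, ‖weakPartial i v‖

theorem gradNorm_nonneg (v : L2 Ω) : 0 ≤ gradNorm v := Finset.sum_nonneg fun _ _ => norm_nonneg _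

theorem sq_norm_L2 (v : L2 Ω) : ‖v‖ ^ 2 = ∫ x in Ω, v x ^ 2 := by
  rw [← real_inner_self_eq_norm_sq, L2.inner_def]
  simp

/-- Ellipticity controls the sum of squares of the ‖∂ᵢv‖; the factor 1/d is the Cauchy–Schwarz loss
for `gradNorm`, which adds the norms themselves. -/
theorem IsEllipticAt.coercive (hd : 1 ≤ d) (hα : 0 < α) {s : ℝ} (hs : IsEllipticAt Ω a α s)
    (v : L2 Ω) : α / d * gradNorm v ^ 2 ≤ form a s v v := by
  have hd' : (0 : ℝ) < d := by exact_mod_cast hd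
  have h1 : gradNorm v ^ 2 ≤ d * ∑ i, ‖weakPartial i v‖ ^ 2 := by
    simpa [gradNorm] using sq_sum_le_card_mul_sum_sq (s := Finset.univ)
      (f := fun i : Fin d => ‖weakPartial i v‖)
  have hsq : ∀ i : Fin d, Integrable (fun x => weakPartial i v x ^ 2) (volume.restrict Ω) :=
    fun i => (Lp.memLp (weakPartial i v)).integrable_sq
  have h2 : α * ∑ i, ‖weakPartial i v‖ ^ 2 ≤ form a s v v := by
    simp_rw [sq_norm_L2]
    rw [← integral_finsetSum _ fun i _ => hsq i, ← integral_const_mul]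
    refine integral_mono_ae ((integrable_finsetSum _ fun i _ => hsq i).const_mul α)
      (integrable_finsetSum _ fun i _ => integrable_finsetSum _ fun j _ =>
        integrable_coeff_mul (hs.memLp i j) _ _) ?_
    filter_upwards [hs.elliptic] with x hx
    simpa [EuclideanSpace.real_norm_sq_eq] using hx (WithLp.toLp 2 fun i => weakPartial i v x)
  refine le_trans ?_ h2
  rw [div_mul_eq_mul_div, div_le_iff₀ hd']
  nlinarith [mul_le_mul_of_nonneg_left h1 hα.le]

theorem abs_integral_coeff_mul_le {c : E d → ℝ} {B : ℝ} (hB : 0 ≤ B)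
    (hc : ∀ᵐ x ∂volume.restrict Ω, |c x| ≤ B) (u v : L2 Ω) :
    |∫ x in Ω, c x * u x * v x| ≤ B * (‖u‖ * ‖v‖) := by
  have hint : Integrable (fun x => |u x| * |v x|) (volume.restrict Ω) := by
    simpa only [← abs_mul] using (integrable_mul_L2 u v).abs
  have h1 : |∫ x in Ω, c x * u x * v x| ≤ ∫ x in Ω, B * (|u x| * |v x|) := by
    rw [← Real.norm_eq_abs]
    refine norm_integral_le_of_norm_le (hint.const_mul B) ?_
    filter_upwards [hc] with x hx
    rw [Real.norm_eq_abs, abs_mul, abs_mul, mul_assoc]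
    exact mul_le_mul_of_nonneg_right hx (by positivity)
  have h2 : ∫ x in Ω, |u x| * |v x| = ⟪|u|, |v|⟫_ℝ := by
    rw [L2.inner_def]
    refine integral_congr_ae ?_
    filter_upwards [Lp.coeFn_abs u, Lp.coeFn_abs v] with x h1 h2
    rw [h1, h2, mul_comm]
    rfl
  rw [integral_const_mul, h2] at h1
  refine h1.trans (mul_le_mul_of_nonneg_left ?_ hB)
  simpa only [norm_abs_eq_norm] using real_inner_le_norm |u| |v|

theorem IsAdmissible.abs_form_sub_le (ha : IsAdmissible Ω T a α ω) {s s' : ℝ}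
    (hs : IsEllipticAt Ω a α s) (hs' : IsEllipticAt Ω a α s') (hsT : s ∈ Icc 0 T)
    (hsT' : s' ∈ Icc 0 T) (u v : L2 Ω) :
    |form a s u v - form a s' u v| ≤ ω |s - s'| * gradNorm u * gradNorm v := by
  have hmem : |s - s'| ∈ Icc 0 T :=
    ⟨abs_nonneg _, abs_sub_le_iff.2 ⟨by linarith [hsT.2, hsT'.1], by linarith [hsT.1, hsT'.2]⟩⟩
  -- With `gradNorm` a plain sum of norms, the double sum over i and j factors exactly, with no
  -- dimensional constant.
  rw [hs.form_eq_sum, hs'.form_eq_sum, ← Finset.sum_sub_distrib, mul_assoc, gradNorm, gradNorm,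
    Finset.sum_mul_sum, Finset.mul_sum]
  refine (Finset.abs_sum_le_sum_abs _ _).trans (Finset.sum_le_sum fun i _ => ?_)
  rw [← Finset.sum_sub_distrib, Finset.mul_sum]
  refine (Finset.abs_sum_le_sum_abs _ _).trans (Finset.sum_le_sum fun j _ => ?_)
  rw [← integral_sub (integrable_coeff_mul (hs.memLp i j) _ _)
    (integrable_coeff_mul (hs'.memLp i j) _ _)]
  simp_rw [← sub_mul]
  exact abs_integral_coeff_mul_le (c := fun x => a i j s x - a i j s' x) (ha.omega_nonneg _ hmem)
    (ha.modulus i j s hsT s' hsT') _ _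

theorem IsAdmissible.integrableOn_form (hΩb : Bornology.IsBounded Ω)
    (ha : IsAdmissible Ω T a α ω) (u v : L2 Ω) :
    IntegrableOn (fun s => form a s u v) (Ioc 0 T) := by
  have := isFiniteMeasure_restrict_of_isBounded hΩb
  rw [IntegrableOn, ← restrict_Ioo_eq_restrict_Ioc]
  refine Integrable.integral_prod_left (f := fun p : ℝ × E d =>
    ∑ i, ∑ j, a i j p.1 p.2 * weakPartial i u p.2 * weakPartial j v p.2) ?_
  refine integrable_finsetSum _ fun i _ => integrable_finsetSum _ fun j _ => ?_
  simp_rw [mul_assoc]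
  exact ((integrable_mul_L2 (weakPartial i u) (weakPartial j v)).comp_snd
    (volume.restrict (Ioo 0 T))).mul_of_top_right (ha.bounded i j)

end Form

/-! ### The discrete operators -/

section DiscreteOp

variable {d : ℕ} {Ω : Set (E d)} {T : ℝ} {a : Fin d → Fin d → ℝ → E d → ℝ} {α : ℝ} {ω : ℝ → ℝ}
  {V : Submodule ℝ (L2 Ω)} [FiniteDimensional ℝ V] {Δ : TimeMesh T}

/-- Riesz representation on the finite-dimensional V, so at elliptic times the default value in
`discreteOp` does not occur. -/
theorem IsEllipticAt.inner_discreteOp (hΩ : IsOpen Ω) (hΩb : Bornology.IsBounded Ω)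
    (hV : V ≤ H10 Ω) {s : ℝ} (hs : IsEllipticAt Ω a α s) (v χ : V) :
    ⟪discreteOp a V s v, χ⟫_ℝ = form a s (v : L2 Ω) (χ : L2 Ω) := by
  have h : ∃ z : V, ∀ χ : V, ⟪(z : L2 Ω), (χ : L2 Ω)⟫_ℝ = form a s (v : L2 Ω) (χ : L2 Ω) := by
    let l : V →ₗ[ℝ] ℝ :=
      { toFun := fun χ => form a s (v : L2 Ω) (χ : L2 Ω)
        map_add' := fun χ ψ => hs.form_add_right hΩ hΩb _ (hV χ.2) (hV ψ.2)
        map_smul' := fun c χ => hs.form_smul_right hΩ hΩb _ c (hV χ.2) }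
    refine ⟨(InnerProductSpace.toDual ℝ V).symm (LinearMap.toContinuousLinearMap l), fun χ => ?_⟩
    exact InnerProductSpace.toDual_symm_apply (𝕜 := ℝ) (E := V)
  rw [discreteOp, dif_pos h]
  exact h.choose_spec χ

/-- In an orthonormal basis of V the coordinates are values of the form, integrable in time. Without
this, the Bochner integral in `avgOp` could be the default 0. -/
theorem IsAdmissible.integrableOn_discreteOp (hΩ : IsOpen Ω) (hΩb : Bornology.IsBounded Ω)
    (ha : IsAdmissible Ω T a α ω) (hV : V ≤ H10 Ω) (v : V) :
    IntegrableOn (fun s => discreteOp a V s v) (Ioc 0 T) := by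
  let b := stdOrthonormalBasis ℝ V
  have hint : IntegrableOn (fun s => ∑ i, form a s (v : L2 Ω) (b i : L2 Ω) • b i) (Ioc 0 T) :=
    integrable_finsetSum _ fun i _ => (ha.integrableOn_form hΩb _ _).smul_const _
  refine hint.congr ?_
  filter_upwards [ha.ae_isEllipticAt] with s hs
  rw [← b.sum_repr' (discreteOp a V s v)]
  refine Finset.sum_congr rfl fun i _ => ?_
  rw [real_inner_comm, hs.inner_discreteOp hΩ hΩb hV]

theorem TimeMesh.Ioc_subset {m : ℕ} (hm : m ≤ Δ.M) : Ioc (Δ.t (m - 1)) (Δ.t m) ⊆ Ioc 0 T :=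
  Ioc_subset_Ioc (Δ.t_nonneg (by omega)) (Δ.t_le hm)

theorem IsAdmissible.inner_avgOp (hΩ : IsOpen Ω) (hΩb : Bornology.IsBounded Ω)
    (ha : IsAdmissible Ω T a α ω) (hV : V ≤ H10 Ω) {m : ℕ} (hm : m ≤ Δ.M) (v χ : V) :
    ⟪avgOp a V Δ m v, χ⟫_ℝ =
      (Δ.step m)⁻¹ * ∫ s in Δ.t (m - 1)..Δ.t m, form a s (v : L2 Ω) (χ : L2 Ω) := by
  have hle := Δ.t_mono (Nat.sub_le m 1) hm
  refine (real_inner_smul_left (F := V) _ _ _).trans ?_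
  rw [intervalIntegral.integral_of_le hle, intervalIntegral.integral_of_le hle, real_inner_comm,
    ← integral_inner ((ha.integrableOn_discreteOp hΩ hΩb hV v).mono_set (TimeMesh.Ioc_subset hm))]
  congr 1
  refine integral_congr_ae ?_
  filter_upwards [ae_restrict_of_ae_restrict_of_subset (TimeMesh.Ioc_subset hm)
    ha.ae_isEllipticAt] with s hs
  rw [real_inner_comm, hs.inner_discreteOp hΩ hΩb hV]

theorem IsAdmissible.avgOp_comm (hΩ : IsOpen Ω) (hΩb : Bornology.IsBounded Ω)
    (ha : IsAdmissible Ω T a α ω) (hV : V ≤ H10 Ω) {m : ℕ} (hm : m ≤ Δ.M) (v χ : V) :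
    ⟪avgOp a V Δ m v, χ⟫_ℝ = ⟪v, avgOp a V Δ m χ⟫_ℝ := by
  have hle := Δ.t_mono (Nat.sub_le m 1) hm
  rw [real_inner_comm _ v, ha.inner_avgOp hΩ hΩb hV hm, ha.inner_avgOp hΩ hΩb hV hm,
    intervalIntegral.integral_of_le hle, intervalIntegral.integral_of_le hle]
  congr 1
  refine integral_congr_ae ?_
  filter_upwards [ae_restrict_of_ae_restrict_of_subset (TimeMesh.Ioc_subset hm)
    ha.ae_isEllipticAt] with s hs
  exact hs.form_comm _ _

/-- The averaged operators as linear maps. -/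
noncomputable def avgLinear (hΩ : IsOpen Ω) (hΩb : Bornology.IsBounded Ω)
    (ha : IsAdmissible Ω T a α ω) (hV : V ≤ H10 Ω) {m : ℕ} (hm : m ≤ Δ.M) : V →ₗ[ℝ] V where
  toFun := avgOp a V Δ m
  -- Linearity is deduced from symmetry: the operator is moved to χ, leaving a pairing linear in its
  -- first argument.
  map_add' u v := ext_inner_right ℝ fun χ => by
    rw [inner_add_left, ha.avgOp_comm hΩ hΩb hV hm, ha.avgOp_comm hΩ hΩb hV hm,
      ha.avgOp_comm hΩ hΩb hV hm, inner_add_left]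
  map_smul' c v := ext_inner_right ℝ fun χ => by
    rw [RingHom.id_apply, real_inner_smul_left, ha.avgOp_comm hΩ hΩb hV hm,
      ha.avgOp_comm hΩ hΩb hV hm, real_inner_smul_left]

theorem le_average_of_ae_le {g : ℝ → ℝ} {p q c : ℝ} (hpq : p < q) (hg : IntegrableOn g (Ioc p q))
    (h : ∀ᵐ s ∂volume.restrict (Ioc p q), c ≤ g s) : c ≤ (q - p)⁻¹ * ∫ s in p..q, g s := by
  have hpos := sub_pos.2 hpq
  rw [intervalIntegral.integral_of_le hpq.le, ← div_eq_inv_mul, le_div_iff₀ hpos]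
  have := integral_mono_ae (integrable_const c) hg h
  rw [setIntegral_const, Real.volume_real_Ioc_of_le hpq.le, smul_eq_mul] at this
  linarith

theorem abs_average_sub_le {g : ℝ → ℝ} {p q c ε : ℝ} (hpq : p < q) (hg : IntegrableOn g (Ioc p q))
    (h : ∀ᵐ s ∂volume.restrict (Ioc p q), |g s - c| ≤ ε) :
    |(q - p)⁻¹ * (∫ s in p..q, g s) - c| ≤ ε := by
  have h1 := le_average_of_ae_le (c := c - ε) hpq hg (h.mono fun s hs => by
    linarith [(abs_le.1 hs).1])
  have h2 := le_average_of_ae_le (g := fun s => -g s) (c := -c - ε) hpq hg.neg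
    (h.mono fun s hs => by linarith [(abs_le.1 hs).2])
  rw [intervalIntegral.integral_neg] at h2
  rw [abs_le]
  constructor <;> linarith

theorem IsAdmissible.avgOp_coercive (hd : 1 ≤ d) (hΩ : IsOpen Ω) (hΩb : Bornology.IsBounded Ω)
    (ha : IsAdmissible Ω T a α ω) (hV : V ≤ H10 Ω) {m : ℕ} (h1 : 1 ≤ m) (hm : m ≤ Δ.M) (v : V) :
    α / d * gradNorm (v : L2 Ω) ^ 2 ≤ ⟪avgOp a V Δ m v, v⟫_ℝ := by
  rw [ha.inner_avgOp hΩ hΩb hV hm]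
  refine le_average_of_ae_le (sub_pos.1 (Δ.step_pos h1 hm))
    ((ha.integrableOn_form hΩb _ _).mono_set (TimeMesh.Ioc_subset hm)) ?_
  filter_upwards [ae_restrict_of_ae_restrict_of_subset (TimeMesh.Ioc_subset hm)
    ha.ae_isEllipticAt] with s hs
  exact hs.coercive hd ha.alpha_pos _

theorem IsAdmissible.abs_avgOp_sub_le (hΩ : IsOpen Ω) (hΩb : Bornology.IsBounded Ω)
    (ha : IsAdmissible Ω T a α ω) (hV : V ≤ H10 Ω) {m n : ℕ} (h1 : 1 ≤ m) (hmn : m ≤ n)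
    (hn : n ≤ Δ.M) (u x : V) :
    |⟪avgOp a V Δ n u - avgOp a V Δ m u, x⟫_ℝ| ≤
      ω (Δ.t n - Δ.t (m - 1)) * gradNorm (u : L2 Ω) * gradNorm (x : L2 Ω) := by
  have hm := hmn.trans hn
  rw [inner_sub_left, ha.inner_avgOp hΩ hΩb hV hn, ha.inner_avgOp hΩ hΩb hV hm]
  -- Averaging twice, over s in I_n and then s' in I_m, reduces the claim to two times at distance
  -- at most t_n - t_{m-1}, where ω is monotone.
  refine abs_average_sub_le (sub_pos.1 (Δ.step_pos (h1.trans hmn) hn))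
    ((ha.integrableOn_form hΩb _ _).mono_set (TimeMesh.Ioc_subset hn)) ?_
  filter_upwards [ae_restrict_of_ae_restrict_of_subset (TimeMesh.Ioc_subset hn)
    ha.ae_isEllipticAt, ae_restrict_mem measurableSet_Ioc] with s hs hsI
  rw [abs_sub_comm]
  refine abs_average_sub_le (sub_pos.1 (Δ.step_pos h1 hm))
    ((ha.integrableOn_form hΩb _ _).mono_set (TimeMesh.Ioc_subset hm)) ?_
  filter_upwards [ae_restrict_of_ae_restrict_of_subset (TimeMesh.Ioc_subset hm)
    ha.ae_isEllipticAt, ae_restrict_mem measurableSet_Ioc] with s' hs' hsI'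
  have hsT := TimeMesh.Ioc_subset hn hsI
  have hsT' := TimeMesh.Ioc_subset hm hsI'
  refine (ha.abs_form_sub_le hs' hs (Ioc_subset_Icc_self hsT') (Ioc_subset_Icc_self hsT) _ _).trans
    ?_
  have h2 := Δ.t_mono (show m - 1 ≤ n - 1 by omega) (by omega)
  have h3 := Δ.t_mono hmn hn
  have h4 := Δ.t_nonneg (m := m - 1) (by omega)
  have h5 := Δ.t_le hn
  have h6 : |s' - s| ≤ Δ.t n - Δ.t (m - 1) :=
    abs_sub_le_iff.2 ⟨by linarith [hsI.1, hsI'.2], by linarith [hsI.2, hsI'.1]⟩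
  have h7 := ha.omega_mono ⟨abs_nonneg _, h6.trans (by linarith)⟩
    ⟨(abs_nonneg _).trans h6, by linarith⟩ h6
  have := gradNorm_nonneg (u : L2 Ω)
  have := gradNorm_nonneg (x : L2 Ω)
  gcongr

end DiscreteOp

/-! ### The fully discrete scheme -/

section FullyDiscrete

variable {d : ℕ} {Ω : Set (E d)} {T : ℝ} {a : Fin d → Fin d → ℝ → E d → ℝ} {α : ℝ} {ω : ℝ → ℝ}
  {V : Submodule ℝ (L2 Ω)} [FiniteDimensional ℝ V] {Δ : TimeMesh T}

/-- The data of the `m`-th step: the integral of `f` over `I_m`, and the initial value if `m = 1`. -/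
noncomputable def stepData (Δ : TimeMesh T) (f : ℝ → L2 Ω) (u₀ : L2 Ω) (m : ℕ) : L2 Ω :=
  (∫ s in Δ.t (m - 1)..Δ.t m, f s) + if m = 1 then u₀ else 0

theorem sum_norm_stepData_le (hT : 0 < T) {f : ℝ → L2 Ω} (hf : IntegrableOn f (Ioc 0 T))
    (u₀ : L2 Ω) :
    ∑ m ∈ Finset.Icc 1 Δ.M, ‖stepData Δ f u₀ m‖ ≤ (∫ t in Ioc 0 T, ‖f t‖) + ‖u₀‖ := by
  have key : ∀ n ≤ Δ.M, ∑ m ∈ Finset.Icc 1 n, ‖∫ s in Δ.t (m - 1)..Δ.t m, f s‖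
      ≤ ∫ t in Ioc 0 (Δ.t n), ‖f t‖ := by
    intro n
    induction n with
    | zero => intro _; simp [Δ.t_zero]
    | succ n ih =>
      intro hn
      have h1 := Δ.t_nonneg (m := n) (by omega)
      have h2 := (Δ.t_lt n (by omega)).le
      have h3 := Δ.t_le hn
      rw [Finset.sum_Icc_succ_top (by omega), Nat.add_sub_cancel,
        ← Ioc_union_Ioc_eq_Ioc h1 h2,
        setIntegral_union (Ioc_disjoint_Ioc_of_le le_rfl) measurableSet_Ioc
          (IntegrableOn.mono_set hf.norm (Ioc_subset_Ioc le_rfl (h2.trans h3)))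
          (IntegrableOn.mono_set hf.norm (Ioc_subset_Ioc h1 h3))]
      refine add_le_add (ih (by omega)) ?_
      rw [intervalIntegral.integral_of_le h2]
      exact norm_integral_le_integral_norm _
  calc _ ≤ ∑ m ∈ Finset.Icc 1 Δ.M,
        (‖∫ s in Δ.t (m - 1)..Δ.t m, f s‖ + if m = 1 then ‖u₀‖ else 0) := by
        refine Finset.sum_le_sum fun m _ => (norm_add_le _ _).trans_eq ?_
        split_ifs <;> simp
    _ ≤ _ := by
        rw [Finset.sum_add_distrib, Finset.sum_ite_eq', if_pos (by simpa using Δ.M_pos hT)]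
        have := key Δ.M le_rfl
        rw [Δ.t_last] at this
        linarith

/-- A test function living on a single interval isolates one Euler step; the value before the first
step counts as 0, whatever `u 0` is. -/
theorem dgForm_single (hΩ : IsOpen Ω) (hΩb : Bornology.IsBounded Ω)
    (ha : IsAdmissible Ω T a α ω) (hV : V ≤ H10 Ω) {m : ℕ} (hm : m ∈ Finset.Icc 1 Δ.M)
    (u : ℕ → V) (χ : V) :
    dgForm a V Δ u (Pi.single m χ) =
      ⟪u m + Δ.step m • avgOp a V Δ m (u m) - (if m = 1 then 0 else u (m - 1)), χ⟫_ℝ := by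
  have hm' := Finset.mem_Icc.1 hm
  have hne : ∀ n, n ≠ m → (((Pi.single m χ : ℕ → V) n : V) : L2 Ω) = 0 := fun n hn => by
    rw [Pi.single_eq_of_ne hn]; rfl
  have h1 : ∑ n ∈ Finset.Icc 1 Δ.M, ∫ s in Δ.t (n - 1)..Δ.t n,
      form a s (u n : L2 Ω) ((Pi.single m χ : ℕ → V) n : L2 Ω)
        = Δ.step m * ⟪avgOp a V Δ m (u m), χ⟫_ℝ := by
    rw [Finset.sum_eq_single m (fun n _ hn => by simp [hne n hn, form_zero_right hΩ hΩb])
      (fun h => absurd hm h), ha.inner_avgOp hΩ hΩb hV hm'.2,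
      mul_inv_cancel_left₀ (Δ.step_pos hm'.1 hm'.2).ne', Pi.single_eq_same]
  have h2 : (∑ n ∈ Finset.Icc 2 Δ.M, ⟪(u n : L2 Ω) - (u (n - 1) : L2 Ω),
      ((Pi.single m χ : ℕ → V) n : L2 Ω)⟫_ℝ) + ⟪(u 1 : L2 Ω), ((Pi.single m χ : ℕ → V) 1 : L2 Ω)⟫_ℝ
        = ⟪u m - (if m = 1 then 0 else u (m - 1)), χ⟫_ℝ := by
    by_cases h : m = 1
    · subst h
      rw [Finset.sum_eq_zero fun n hn => by
        rw [hne n (by rw [Finset.mem_Icc] at hn; omega), inner_zero_right], Pi.single_eq_same,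
        if_pos rfl, sub_zero, zero_add]
      rfl
    · rw [hne 1 (Ne.symm h), inner_zero_right, add_zero, if_neg h,
        Finset.sum_eq_single m (fun n _ hn => by rw [hne n hn, inner_zero_right])
          (fun h' => absurd (Finset.mem_Icc.2 ⟨by omega, hm'.2⟩) h'), Pi.single_eq_same]
      rfl
  rw [dgForm, h1, add_assoc, h2, add_sub_right_comm, inner_add_left, add_comm]
  congr 1
  exact (real_inner_smul_left (F := V) _ _ _).symm

/-- The initial datum acts as a load on the first step. It need not lie in V, so it enters through
the L² projection, together with f. -/
theorem IsFullyDiscreteSolution.step_eq (hΩ : IsOpen Ω) (hΩb : Bornology.IsBounded Ω)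
    (ha : IsAdmissible Ω T a α ω) (hV : V ≤ H10 Ω) {f : ℝ → L2 Ω}
    (hf : IntegrableOn f (Ioc 0 T)) {u₀ : L2 Ω} {u : ℕ → V}
    (hu : IsFullyDiscreteSolution a V Δ f u₀ u) {m : ℕ} (hm : m ∈ Finset.Icc 1 Δ.M) :
    u m + Δ.step m • avgOp a V Δ m (u m) =
      (if m = 1 then 0 else u (m - 1)) + V.orthogonalProjectionOnto (stepData Δ f u₀ m) := by
  have hm' := Finset.mem_Icc.1 hm
  rw [← sub_eq_iff_eq_add']
  refine ext_inner_right ℝ fun χ => ?_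
  have hne : ∀ n, n ≠ m → (((Pi.single m χ : ℕ → V) n : V) : L2 Ω) = 0 := fun n hn => by
    rw [Pi.single_eq_of_ne hn]; rfl
  rw [← dgForm_single hΩ hΩb ha hV hm, hu, Submodule.inner_orthogonalProjectionOnto_eq_of_mem_right,
    stepData, inner_add_left, Finset.sum_eq_single m (fun n _ hn => by simp [hne n hn])
      (fun h => absurd hm h), Pi.single_eq_same]
  congr 1
  · have hle := Δ.t_mono (Nat.sub_le m 1) hm'.2
    rw [intervalIntegral.integral_of_le hle, intervalIntegral.integral_of_le hle, real_inner_comm,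
      ← integral_inner (hf.mono_set (TimeMesh.Ioc_subset hm'.2))]
    simp_rw [real_inner_comm]
  · by_cases h : m = 1
    · subst h
      rw [Pi.single_eq_same, if_pos rfl]
    · rw [hne 1 (Ne.symm h), if_neg h, inner_zero_left, inner_zero_right]

/-- The Euler step expresses the increment by the load and k_m A_m u_m. The first jump starts from
u₀ rather than 0, which costs the extra ‖u₀‖. -/
theorem norm_jump_le (hΩ : IsOpen Ω) (hΩb : Bornology.IsBounded Ω)
    (ha : IsAdmissible Ω T a α ω) (hV : V ≤ H10 Ω) {f : ℝ → L2 Ω}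
    (hf : IntegrableOn f (Ioc 0 T)) {u₀ : L2 Ω} {u : ℕ → V}
    (hu : IsFullyDiscreteSolution a V Δ f u₀ u) {m : ℕ} (hm : m ∈ Finset.Icc 1 Δ.M) :
    ‖jump u₀ u (m - 1)‖ ≤ Δ.step m * ‖avgOp a V Δ m (u m)‖ + ‖stepData Δ f u₀ m‖ +
      if m = 1 then ‖u₀‖ else 0 := by
  have hm' := Finset.mem_Icc.1 hm
  have hk := Δ.step_pos hm'.1 hm'.2
  set P := V.orthogonalProjectionOnto (stepData Δ f u₀ m) with hP
  have h1 : u m - (if m = 1 then 0 else u (m - 1)) = P - Δ.step m • avgOp a V Δ m (u m) := by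
    have := hu.step_eq hΩ hΩb ha hV hf hm
    rw [sub_eq_sub_iff_add_eq_add, this, add_comm]
  have h2 : ‖u m - (if m = 1 then 0 else u (m - 1))‖
      ≤ Δ.step m * ‖avgOp a V Δ m (u m)‖ + ‖stepData Δ f u₀ m‖ := by
    rw [h1, add_comm]
    refine (norm_sub_le _ _).trans (add_le_add (V.norm_orthogonalProjectionOnto_apply_le _) ?_)
    rw [norm_smul, Real.norm_of_nonneg hk.le]
  by_cases h : m = 1
  · subst h
    rw [if_pos rfl, sub_zero] at h2
    rw [if_pos rfl]
    exact (norm_sub_le _ _).trans (add_le_add h2 le_rfl)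
  · rw [if_neg h] at h2
    rw [if_neg h, add_zero, jump, if_neg (by omega), Nat.sub_add_cancel hm'.1]
    exact h2

theorem sum_norm_avgOp_le (hd : 1 ≤ d) (hΩ : IsOpen Ω) (hΩb : Bornology.IsBounded Ω) (hT : 0 < T)
    (ha : IsAdmissible Ω T a α ω) (hV : V ≤ H10 Ω) {c β κ : ℝ} (hc : 0 < c) (hκ : 0 < κ)
    (hreg : Δ.IsRegular c β κ) {f : ℝ → L2 Ω}
    (hf : IntegrableOn f (Ioc 0 T)) {u₀ : L2 Ω} {u : ℕ → V}
    (hu : IsFullyDiscreteSolution a V Δ f u₀ u) :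
    ∑ m ∈ Finset.Icc 1 Δ.M, Δ.step m * ‖avgOp a V Δ m (u m)‖ ≤
      (1 + |Real.log (T / (c * T ^ β))| + β + √(2 * (1 + κ) / (α / d)) * √(T / (α / d)) *
        ∫ s in Ioc 0 T, ω s / s ^ (3 / 2 : ℝ)) * Real.log (T / Δ.kmax) *
        ∑ m ∈ Finset.Icc 1 Δ.M, ‖V.orthogonalProjectionOnto (stepData Δ f u₀ m)‖ := by
  have hd' : (0 : ℝ) < d := by exact_mod_cast hd
  -- The abstract scheme wants linear maps for all indices and value 0 at index 0; the fillers
  -- beyond M and at 0 do not affect the sums.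
  let A : ℕ → V →ₗ[ℝ] V := fun m =>
    if h : m ≤ Δ.M then avgLinear hΩ hΩb ha hV h else 0
  have hA : ∀ m ≤ Δ.M, ∀ x, A m x = avgOp a V Δ m x := fun m h x => by
    simp only [A, dif_pos h]
    rfl
  let v : ℕ → V := fun m => if m = 0 then 0 else u m
  have hv : ∀ m, 1 ≤ m → v m = u m := fun m h => if_neg (by omega)
  have hmain := sum_norm_operator_le_of_scheme (A := A) (v := v)
    (F := fun m => V.orthogonalProjectionOnto (stepData Δ f u₀ m)) (N := fun x => gradNorm (x : L2 Ω))
    hT hreg hc hκ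
    (fun n hn x y => by
      rw [Finset.mem_Icc] at hn
      rw [hA n hn.2, hA n hn.2]
      exact ha.avgOp_comm hΩ hΩb hV hn.2 x y)
    (fun x => gradNorm_nonneg _) (div_pos ha.alpha_pos hd')
    (fun n hn x => by
      rw [Finset.mem_Icc] at hn
      rw [hA n hn.2]
      exact ha.avgOp_coercive hd hΩ hΩb hV hn.1 hn.2 x)
    ha.omega_nonneg ha.omega_anti ha.omega_int
    (fun n hn m hm x y => by
      rw [Finset.mem_Icc] at hn hm
      rw [hA n hn.2, hA m (hm.2.trans hn.2)]
      exact ha.abs_avgOp_sub_le hΩ hΩb hV hm.1 hm.2 hn.2 x y)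
    (if_pos rfl)
    (fun m hm => by
      have hm' := Finset.mem_Icc.1 hm
      have h := hu.step_eq hΩ hΩb ha hV hf hm
      rw [hA m hm'.2, hv m hm'.1, h]
      congr 1
      simp only [v, show m - 1 = 0 ↔ m = 1 by omega])
  refine le_of_eq_of_le (Finset.sum_congr rfl fun m hm => ?_) hmain
  rw [Finset.mem_Icc] at hm
  rw [hA m hm.2, hv m hm.1]

end FullyDiscrete

end DGParabolic

/-! ### Assembly of the final bound. -/

theorem theorem3p5 {d : ℕ} (hd : 1 ≤ d) (Ω : Set (DGParabolic.E d)) (hΩ : IsOpen Ω)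
    (hΩb : Bornology.IsBounded Ω) (T : ℝ) (hT : 0 < T)
    (a : Fin d → Fin d → ℝ → DGParabolic.E d → ℝ) (α : ℝ) (ω : ℝ → ℝ)
    (ha : DGParabolic.IsAdmissible Ω T a α ω)
    (c β κ : ℝ) (hc : 0 < c) (hβ : 0 < β) (hκ : 0 < κ) :
    ∃ μ > (0 : ℝ), ∃ δ₀ > (0 : ℝ), ∃ C > (0 : ℝ),
      ∀ (Δ : DGParabolic.TimeMesh T), Δ.IsRegular c β κ → Δ.kmax - Δ.kmin ≤ δ₀ →
      ∀ (𝒯 : DGParabolic.Triangulation Ω) (r : ℕ), 1 ≤ r →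
      ∀ (f : ℝ → DGParabolic.L2 Ω) (u₀ : DGParabolic.L2 Ω), IntegrableOn f (Ioc 0 T) →
      ∀ (u : ℕ → DGParabolic.feSpace 𝒯 r),
        DGParabolic.IsFullyDiscreteSolution a (DGParabolic.feSpace 𝒯 r) Δ f u₀ u →
        ∑ m ∈ Finset.Icc 1 Δ.M,
            (Δ.step m * ‖DGParabolic.avgOp a (DGParabolic.feSpace 𝒯 r) Δ m (u m)‖
              + ‖DGParabolic.jump u₀ u (m - 1)‖)
          ≤ C * Real.exp (μ * T) * Real.log (T / Δ.kmax)
              * ((∫ t in Ioc 0 T, ‖f t‖) + ‖u₀‖) := by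
  set C₀ := 1 + |Real.log (T / (c * T ^ β))| + β + √(2 * (1 + κ) / (α / d)) * √(T / (α / d)) *
    ∫ s in Ioc 0 T, ω s / s ^ (3 / 2 : ℝ) with hC₀
  have hW : 0 ≤ ∫ s in Ioc 0 T, ω s / s ^ (3 / 2 : ℝ) :=
    setIntegral_nonneg measurableSet_Ioc fun s hs =>
      div_nonneg (ha.omega_nonneg s ⟨hs.1.le, hs.2⟩) (Real.rpow_nonneg hs.1.le _)
  have hC₀0 : 0 ≤ C₀ := by positivity
  -- Jumps repeat the operator bound, giving 2 C₀, and add the data and ‖u₀‖, giving 2 since log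
  -- (T/k) ≥ 1. Of the exponential only e^{μT} ≥ 1 is needed.
  refine ⟨1, one_pos, 1, one_pos, 2 * C₀ + 2, by positivity, ?_⟩
  intro Δ hreg _ 𝒯 r _ f u₀ hf u hu
  have := DGParabolic.finiteDimensional_feSpace hΩ 𝒯 r
  have hV : DGParabolic.feSpace 𝒯 r ≤ DGParabolic.H10 Ω := fun v hv => hv.1
  have hmain := DGParabolic.sum_norm_avgOp_le hd hΩ hΩb hT ha hV hc hκ hreg hf hu
  have hL := (hreg.one_add_log_le hT hc le_rfl (Δ.M_pos hT)).2
  have hdata := DGParabolic.sum_norm_stepData_le (Δ := Δ) hT hf u₀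
  have hproj : ∑ m ∈ Finset.Icc 1 Δ.M, ‖(DGParabolic.feSpace 𝒯 r).orthogonalProjectionOnto
      (DGParabolic.stepData Δ f u₀ m)‖ ≤ ∑ m ∈ Finset.Icc 1 Δ.M, ‖DGParabolic.stepData Δ f u₀ m‖ :=
    Finset.sum_le_sum fun m _ => Submodule.norm_orthogonalProjectionOnto_apply_le _ _
  have hjump := Finset.sum_le_sum fun m hm =>
    DGParabolic.norm_jump_le hΩ hΩb ha hV hf hu (m := m) hm
  rw [Finset.sum_add_distrib, Finset.sum_add_distrib, Finset.sum_ite_eq',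
    if_pos (by simpa using Δ.M_pos hT)] at hjump
  rw [Finset.sum_add_distrib]
  have hR0 : 0 ≤ ∫ t in Ioc 0 T, ‖f t‖ := integral_nonneg fun _ => norm_nonneg _
  rw [← hC₀] at hmain
  set L := Real.log (T / Δ.kmax)
  set R := (∫ t in Ioc 0 T, ‖f t‖) + ‖u₀‖
  have hu₀R : ‖u₀‖ ≤ R := le_add_of_nonneg_left hR0
  have hR : 0 ≤ R := (norm_nonneg _).trans hu₀R
  have h1 : C₀ * L * (∑ m ∈ Finset.Icc 1 Δ.M, ‖(DGParabolic.feSpace 𝒯 r).orthogonalProjectionOnto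
      (DGParabolic.stepData Δ f u₀ m)‖) ≤ C₀ * L * R :=
    mul_le_mul_of_nonneg_left (hproj.trans hdata) (mul_nonneg hC₀0 (by linarith))
  have h2 : R ≤ L * R := le_mul_of_one_le_left hR hL
  have h3 : 1 ≤ Real.exp (1 * T) := Real.one_le_exp (by linarith)
  calc _ ≤ (2 * C₀ + 2) * L * R := by linarith
    _ ≤ Real.exp (1 * T) * ((2 * C₀ + 2) * L * R) :=
        le_mul_of_one_le_left (by positivity) h3
    _ = _ := by ring
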